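/- For $\kappa>0$ let $c_\kappa$ be the unique root in $(\sqrt\kappa,\infty)$ of $$z^{\kappa}\big[(z-\sqrt\kappa)^2+1\big]=e^{(z^2-\kappa)/2}\,\kappa^{\kappa/2},$$ and let $c_0$ be the unique positive root of $z^2+1=e^{z^2/2}$. For $\kappa\ge 0$ let $(\rho_\kappa,v_\kappa,\phi_\kappa)$ be the peaked solitary wave of the one-dimensional Euler–Poisson system with Boltzmann electrons, travelling with speed $c=c_\kappa$ and with peak at $\xi=0$. This means that, with $\rho=\rho_\kappa$, $v=v_\kappa$, $\phi=\phi_\kappa$: * $\rho,v$ are $C^1$ and $\phi$ is $C^2$ on $\mathbb R\setminus\{0\}$, where $$-c\rho'+(\rho v)'=0,\qquad \rho(-cv'+vv')+\kappa\rho'=-\rho\phi',\qquad -\phi''=\rho-e^{\phi};$$ * $(\rho,v,\phi)\to(1,0,0)$ as $\xi\to-\infty$; * $\rho,v,\phi$ are even, and $\rho',v',\phi'>0$ on $(-\infty,0)$; * $\phi$ is differentiable at $0$, $v$ is continuous at $0$, and if $\rho$ has a finite limit at $0$, then $\rho(0)$ is this limit; * at $\xi=0$ the left and right derivatives of $(\rho,v)$,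 possibly infinite, are different: this holds for at least one of $\rho$ and $v$. Then the following hold as $\kappa\to0^+$. 1. For every $\alpha\in(0,1/3)$: $\phi_\kappa\in C^{1,\alpha}(\mathbb R)$ for all $\kappa\ge0$, and $\phi_\kappa\to\phi_0$ in $C^{1,\alpha}(\mathbb R)$. 2. For every $p\in[1,3/2)$: $\rho_\kappa-1\in L^p(\mathbb R)$ for all $\kappa\ge0$, and $\rho_\kappa-1\to\rho_0-1$ in $L^p(\mathbb R)$. 3. For every $\beta\in(0,2/3)$: $v_\kappa\in C^{\beta}(\mathbb R)$ for all $\kappa\ge0$, and $v_\kappa\to v_0$ in $C^{\beta}(\mathbb R)$. The three ranges of exponents are sharp. With norms allowed to take the value $\infty$: 4. For every $\alpha\in[1/3,1]$ there is $\delta>0$ such that $\|\phi_\kappa-\phi_0\|_{C^{1,\alpha}(\mathbb R)}\ge\delta$ for all $\kappa>0$. 5. For every $p\in[3/2,\infty]$: $\rho_0-1\notin L^p(\mathbb R)$, and $\|\rho_\kappa-\rho_0\|_{L^p(\mathbb R)}=\infty$ for all $\kappa>0$. 6. For every $\beta\in[2/3,1]$ there is $\delta>0$ such that $\|v_\kappa-v_0\|_{C^{\beta}(\mathbb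 R)}\ge\delta$ for all $\kappa>0$. Here $\|f\|_{C^\beta}=\sup|f|+[f]_\beta$ and $\|f\|_{C^{1,\alpha}}=\sup|f|+\sup|f'|+[f']_\alpha$, where $[f]_\beta=\sup_{x\ne y}|f(x)-f(y)|/|x-y|^\beta$. -/

import Mathlib

open Filter Topology MeasureTheory
open scoped NNReal ENNReal

noncomputable section

/-- `c` is the critical speed `c_κ`: for `κ > 0` the root of
`z^κ [(z - √κ)² + 1] = exp((z² - κ)/2) κ^(κ/2)` on the interval `(√κ, ∞)`, and for `κ = 0` the
positive root of `z² + 1 = exp(z²/2)`. -/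
def IsCriticalSpeed (κ c : ℝ) : Prop :=
  (0 < κ ∧ √κ < c ∧
    c ^ κ * ((c - √κ) ^ 2 + 1) = Real.exp ((c ^ 2 - κ) / 2) * κ ^ (κ / 2)) ∨
  (κ = 0 ∧ 0 < c ∧ c ^ 2 + 1 = Real.exp (c ^ 2 / 2))

/-- The left and the right derivative of `f` at `0` exist, as finite or infinite limits of
difference quotients, and are different. -/
def DistinctOneSidedDerivs (f : ℝ → ℝ) : Prop :=
  ∃ l r : EReal, l ≠ r ∧
    Tendsto (fun ξ : ℝ => (((f ξ - f 0) / ξ : ℝ) : EReal)) (𝓝[<] 0) (𝓝 l) ∧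
    Tendsto (fun ξ : ℝ => (((f ξ - f 0) / ξ : ℝ) : EReal)) (𝓝[>] 0) (𝓝 r)

/-- `(ρ, v, φ)` is a peaked solitary wave, with peak at `ξ = 0`, of the one-dimensional
Euler-Poisson system with temperature ratio `κ`, travelling with speed `c`. The wave is a classical
solution of the travelling wave equations on `ℝ \ {0}`. The fields `phi_differentiable`,
`v_continuous` and `rho_value` say what happens at the peak itself: the potential has no corner
there, `v` is continued by its limit, and so is `ρ` if its limit is finite (for `κ = 0` the
density tends to `+∞` at the peak, and the real number `ρ 0` carries no information). -/
structure IsPeakedSolitaryWave (κ c : ℝ) (ρ v φ : ℝ → ℝ) : Prop where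
  rho_smooth : ContDiffOn ℝ 1 ρ {0}ᶜ
  v_smooth : ContDiffOn ℝ 1 v {0}ᶜ
  phi_smooth : ContDiffOn ℝ 2 φ {0}ᶜ
  mass : ∀ ξ, ξ ≠ 0 → -c * deriv ρ ξ + deriv (fun η => ρ η * v η) ξ = 0
  momentum : ∀ ξ, ξ ≠ 0 →
    ρ ξ * (-c * deriv v ξ + v ξ * deriv v ξ) + κ * deriv ρ ξ = -ρ ξ * deriv φ ξ
  poisson : ∀ ξ, ξ ≠ 0 → -deriv (deriv φ) ξ = ρ ξ - Real.exp (φ ξ)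
  rho_far : Tendsto ρ atBot (𝓝 1)
  v_far : Tendsto v atBot (𝓝 0)
  phi_far : Tendsto φ atBot (𝓝 0)
  rho_even : ∀ ξ, ξ ≠ 0 → ρ ξ = ρ (-ξ)
  v_even : ∀ ξ, ξ ≠ 0 → v ξ = v (-ξ)
  phi_even : ∀ ξ, ξ ≠ 0 → φ ξ = φ (-ξ)
  rho_mono : ∀ ξ, ξ < 0 → 0 < deriv ρ ξ
  v_mono : ∀ ξ, ξ < 0 → 0 < deriv v ξ
  phi_mono : ∀ ξ, ξ < 0 → 0 < deriv φ ξ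
  phi_differentiable : DifferentiableAt ℝ φ 0
  v_continuous : ContinuousAt v 0
  rho_value : ∀ a : ℝ, Tendsto ρ (𝓝[≠] 0) (𝓝 a) → ρ 0 = a
  peak : DistinctOneSidedDerivs ρ ∨ DistinctOneSidedDerivs v

/-- The norm of `C^β(ℝ)`, `sup |f| + [f]_β`, with value `∞` if it is not finite. Mathlib's
`eHolderNorm β f` is the Hölder seminorm `[f]_β`. -/
def holderENorm (β : ℝ≥0) (f : ℝ → ℝ) : ℝ≥0∞ :=
  (⨆ x, ‖f x‖ₑ) + eHolderNorm β f

/-- The norm of `C^{1,α}(ℝ)`, `sup |f| + sup |f'| + [f']_α`, for a `C¹` function `f`. -/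
def c1HolderENorm (α : ℝ≥0) (f : ℝ → ℝ) : ℝ≥0∞ :=
  (⨆ x, ‖f x‖ₑ) + holderENorm α (deriv f)

/-- `f ∈ C^β(ℝ)`. -/
def MemHolderSpace (β : ℝ≥0) (f : ℝ → ℝ) : Prop :=
  holderENorm β f < ∞

/-- `f ∈ C^{1,α}(ℝ)`. -/
def MemC1HolderSpace (α : ℝ≥0) (f : ℝ → ℝ) : Prop :=
  ContDiff ℝ 1 f ∧ c1HolderENorm α f < ∞

end

/-! Write s = √κ and u = c - v for the speed relative to the wave. Conservation of mass gives ρ =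
c/u, the momentum equation integrates to a Bernoulli law φ = `potentialOf s c u`, and the Poisson
equation times φ' integrates to φ'²/2 = `energyOf s c u`. Before the peak the wave is thus governed
by one autonomous equation v' = `slopeOf s c u`, with u decreasing from c to its value at the peak.
A smooth crest is excluded by the peak condition, so the peak is sonic, u = s
(`IsPeakedSolitaryWave.v_zero`). The equation for the critical speed says that the energy vanishes
there.

The key estimate is `exists_slopeBounds`. The energy is comparable to (c - u)² (u - s)²/u, and after
the factor u - s cancels, the slope is comparable to (c - u)/√u, with constants uniform for (s, c)
near (0, c₀). Hence v decays exponentially, and near the peak u^(3/2) is at least a multiple of |x|.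
This gives ρ - 1 = O(|x|^(-2/3)) and v' = O(|x|^(-1/3)), uniformly in κ (`exists_wave_bounds`).

Pointwise convergence comes from inverting the profile: the integral of 1/slope up to u is the
distance to the peak (`ReducedWave.travelOf_eq`). These integrals converge as s → 0 and are
increasing in u, so their inverses converge too. Dominated convergence then gives convergence in L^p
of ρ, v' and φ'' = exp φ - ρ. Morrey's inequality with q = 1/(1 - β) turns the last two into Hölder
convergence: the condition q/3 < 1 is β < 2/3, and 2q/3 < 1 is α < 1/3.

For sharpness, the cold wave really has u of order |x|^(2/3) and φ' of order at least |x|^(1/3) at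
the peak, while at κ > 0 both u - s and φ' are at most linear in |x| and ρ is bounded. The
difference therefore keeps the singularity of the cold wave, with a constant independent of κ. -/

/-! ### The critical speed -/

/-- The function whose zeros `c > s = √κ` are the critical speeds. -/
noncomputable def speedFn (s c : ℝ) : ℝ :=
  s ^ 2 * (Real.log c - Real.log s) + Real.log (1 + (c - s) ^ 2) - (c ^ 2 - s ^ 2) / 2

/-- `c` is a critical speed for the thermal speed `s = √κ`. -/
structure CriticalPair (s c : ℝ) : Prop where
  nonneg : 0 ≤ s
  lt : s < c
  eq_zero : speedFn s c = 0

lemma CriticalPair.pos {s c : ℝ} (h : CriticalPair s c) : 0 < c := h.nonneg.trans_lt h.lt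

lemma speedFn_self (s : ℝ) : speedFn s s = 0 := by simp [speedFn]

/-- In this factored form the sign is visible: beyond s it changes only once, where c² = 1 + s². -/
lemma hasDerivAt_speedFn (s : ℝ) {c : ℝ} (hc : 0 < c) :
    HasDerivAt (speedFn s)
      ((c - s) ^ 2 * (1 - (c ^ 2 - s ^ 2)) / (c * (1 + (c - s) ^ 2))) c := by
  have h0 : 1 + (c - s) ^ 2 ≠ 0 := by positivity
  have h1 := (((Real.hasDerivAt_log hc.ne').sub_const (Real.log s)).const_mul (s ^ 2))
  have h2 := ((((hasDerivAt_id c).sub_const s).pow 2).const_add 1).log h0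
  have h3 := (((hasDerivAt_id c).pow 2).sub_const (s ^ 2)).div_const 2
  refine ((h1.add h2).sub h3).congr_deriv ?_
  simp only [id, Pi.pow_apply, Nat.cast_ofNat, Nat.add_one_sub_one, pow_one, mul_one]
  have h0' : 1 + (c - s) ^ 2 ≠ 0 := h0
  field_simp
  ring

lemma continuousOn_speedFn {s : ℝ} (hs : 0 ≤ s) : ContinuousOn (speedFn s) (Set.Ici s) := by
  rcases hs.eq_or_lt with rfl | hs
  -- For s = 0 the term with log c has coefficient zero, so the endpoint c = 0 is harmless.
  · have : speedFn 0 = fun c => Real.log (1 + c ^ 2) - c ^ 2 / 2 := by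
      funext c; simp [speedFn]
    rw [this]
    refine Continuous.continuousOn ?_
    refine Continuous.sub (Continuous.log (by fun_prop) fun x => by positivity) (by fun_prop)
  · exact fun c hc => (hasDerivAt_speedFn s (hs.trans_le hc)).continuousAt.continuousWithinAt

lemma strictMonoOn_speedFn {s : ℝ} (hs : 0 ≤ s) :
    StrictMonoOn (speedFn s) (Set.Icc s (√(1 + s ^ 2))) := by
  refine strictMonoOn_of_deriv_pos (convex_Icc _ _)
    ((continuousOn_speedFn hs).mono Set.Icc_subset_Ici_self) fun x hx => ?_
  rw [interior_Icc] at hx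
  have hx0 : 0 < x := hs.trans_lt hx.1
  rw [(hasDerivAt_speedFn s hx0).deriv]
  have h1 : x ^ 2 < 1 + s ^ 2 := (Real.lt_sqrt hx0.le).1 hx.2
  have h2 : 0 < x - s := sub_pos.2 hx.1
  have h3 : 0 < 1 - (x ^ 2 - s ^ 2) := by linarith
  positivity

lemma strictAntiOn_speedFn {s : ℝ} (hs : 0 ≤ s) :
    StrictAntiOn (speedFn s) (Set.Ici (√(1 + s ^ 2))) := by
  have hs' : s < √(1 + s ^ 2) := Real.lt_sqrt_of_sq_lt (by linarith)
  refine strictAntiOn_of_deriv_neg (convex_Ici _)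
    ((continuousOn_speedFn hs).mono (Set.Ici_subset_Ici.2 hs'.le)) fun x hx => ?_
  rw [interior_Ici] at hx
  have hx0 : 0 < x := hs.trans_lt (hs'.trans hx)
  rw [(hasDerivAt_speedFn s hx0).deriv]
  have h1 : 1 + s ^ 2 < x ^ 2 := (Real.sqrt_lt' hx0).1 hx
  have h2 : 0 < x - s := sub_pos.2 (hs'.trans hx)
  refine div_neg_of_neg_of_pos (mul_neg_of_pos_of_neg (by positivity) (by linarith))
    (by positivity)

lemma lt_sqrt_one_add_sq (s : ℝ) : s < √(1 + s ^ 2) := Real.lt_sqrt_of_sq_lt (by linarith)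

/-- `speedFn s` starts from zero at s and strictly increases up to √(1 + s²), so its next zero lies
beyond. -/
lemma CriticalPair.sqrt_lt {s c : ℝ} (h : CriticalPair s c) : √(1 + s ^ 2) < c := by
  by_contra! hle
  have := strictMonoOn_speedFn h.nonneg ⟨le_rfl, (lt_sqrt_one_add_sq s).le⟩ ⟨h.lt.le, hle⟩ h.lt
  rw [speedFn_self, h.eq_zero] at this
  exact lt_irrefl _ this

/-- A critical speed is supersonic. -/
lemma CriticalPair.supersonic {s c : ℝ} (h : CriticalPair s c) : 1 + s ^ 2 < c ^ 2 :=
  (Real.sqrt_lt' h.pos).1 h.sqrt_lt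

lemma CriticalPair.one_lt {s c : ℝ} (h : CriticalPair s c) : 1 < c := by
  nlinarith [h.supersonic, h.pos, sq_nonneg s]

lemma CriticalPair.speedFn_pos {s c z : ℝ} (h : CriticalPair s c) (hz : s < z) (hzc : z < c) :
    0 < speedFn s z := by
  rcases le_total z (√(1 + s ^ 2)) with hle | hle
  · have := strictMonoOn_speedFn h.nonneg ⟨le_rfl, (lt_sqrt_one_add_sq s).le⟩ ⟨hz.le, hle⟩ hz
    rwa [speedFn_self] at this
  · have := strictAntiOn_speedFn h.nonneg hle h.sqrt_lt.le hzc
    rwa [h.eq_zero] at this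

lemma CriticalPair.speedFn_neg {s c z : ℝ} (h : CriticalPair s c) (hz : c < z) :
    speedFn s z < 0 := by
  have := strictAntiOn_speedFn h.nonneg h.sqrt_lt.le (h.sqrt_lt.trans hz).le hz
  rwa [h.eq_zero] at this

/-- The difference of the two sides has derivative t - log (1 + t), which is positive for t > 0. -/
lemma one_add_mul_log_lt {t : ℝ} (ht : 0 < t) : (1 + t) * Real.log (1 + t) < t + t ^ 2 / 2 := by
  have hmono : StrictMonoOn (fun t : ℝ => t + t ^ 2 / 2 - (1 + t) * Real.log (1 + t))
      (Set.Ici 0) := by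
    have hd : ∀ x : ℝ, 0 ≤ x → HasDerivAt
        (fun t : ℝ => t + t ^ 2 / 2 - (1 + t) * Real.log (1 + t)) (x - Real.log (1 + x)) x := by
      intro x hx
      have h0 : (1 + x) ≠ 0 := by positivity
      have h1 := (hasDerivAt_id x).add (((hasDerivAt_id x).pow 2).div_const 2)
      have h2 := ((hasDerivAt_id x).const_add 1).mul (((hasDerivAt_id x).const_add 1).log h0)
      refine (h1.sub h2).congr_deriv ?_
      simp only [id]
      field_simp
      ring
    refine strictMonoOn_of_deriv_pos (convex_Ici 0)
      (fun x hx => (hd x hx).continuousAt.continuousWithinAt) fun x hx => ?_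
    rw [interior_Ici] at hx
    have hx' : 0 < x := hx
    rw [(hd x hx'.le).deriv]
    have := Real.log_lt_sub_one_of_pos (x := 1 + x) (by positivity) (by linarith)
    linarith
  have := hmono (Set.self_mem_Ici) (Set.mem_Ici.2 ht.le) ht
  simp at this
  linarith

/-- This makes the charge at the sonic point positive. If it failed, s + s⁻¹ would lie in (s, c],
where `speedFn s` is nonnegative; but with t = s⁻² its value there is s² ((1 + t) log (1 + t) - t -
t²/2) < 0. -/
lemma CriticalPair.mul_sub_lt_one {s c : ℝ} (h : CriticalPair s c) : s * (c - s) < 1 := by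
  rcases h.nonneg.eq_or_lt with rfl | hs
  · simp
  by_contra! hle
  have hle' : s + s⁻¹ ≤ c := by
    have : s⁻¹ ≤ c - s := (inv_le_iff_one_le_mul₀' hs).2 hle
    linarith
  have hnonneg : 0 ≤ speedFn s (s + s⁻¹) := by
    rcases hle'.eq_or_lt with heq | hlt
    · rw [heq, h.eq_zero]
    · exact (h.speedFn_pos (lt_add_of_pos_right s (inv_pos.2 hs)) hlt).le
  have ht : 0 < (s ^ 2)⁻¹ := by positivity
  have key := one_add_mul_log_lt ht
  have e1 : Real.log (s + s⁻¹) - Real.log s = Real.log (1 + (s ^ 2)⁻¹) := by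
    rw [← Real.log_div (by positivity) hs.ne']
    congr 1
    field_simp
  have e2 : (s + s⁻¹ - s) ^ 2 = (s ^ 2)⁻¹ := by rw [add_sub_cancel_left, inv_pow]
  rw [speedFn, e1, e2] at hnonneg
  have e3 : (s + s⁻¹) ^ 2 - s ^ 2 = 2 + (s ^ 2)⁻¹ := by field_simp; ring
  rw [e3] at hnonneg
  have h4 := mul_lt_mul_of_pos_left key (pow_pos hs 2)
  have h5 : s ^ 2 * ((1 + (s ^ 2)⁻¹) * Real.log (1 + (s ^ 2)⁻¹)) =
      s ^ 2 * Real.log (1 + (s ^ 2)⁻¹) + Real.log (1 + (s ^ 2)⁻¹) := by field_simp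
  have h6 : s ^ 2 * ((s ^ 2)⁻¹ + (s ^ 2)⁻¹ ^ 2 / 2) = (2 + (s ^ 2)⁻¹) / 2 := by field_simp
  rw [h5, h6] at h4
  linarith

lemma IsCriticalSpeed.criticalPair {κ c : ℝ} (h : IsCriticalSpeed κ c) : CriticalPair (√κ) c := by
  rcases h with ⟨hκ, hlt, heq⟩ | ⟨rfl, hc, heq⟩
  · have hs : 0 < √κ := Real.sqrt_pos.2 hκ
    have hc : 0 < c := hs.trans hlt
    refine ⟨hs.le, hlt, ?_⟩
    have := congrArg Real.log heq
    rw [Real.log_mul (Real.rpow_pos_of_pos hc _).ne' (by positivity), Real.log_rpow hc,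
      Real.log_mul (Real.exp_pos _).ne' (Real.rpow_pos_of_pos hκ _).ne', Real.log_exp,
      Real.log_rpow hκ] at this
    rw [speedFn, Real.sq_sqrt hκ.le, Real.log_sqrt hκ.le, add_comm (1 : ℝ)]
    linarith
  · rw [Real.sqrt_zero]
    refine ⟨le_rfl, hc, ?_⟩
    have := congrArg Real.log heq
    rw [Real.log_exp, add_comm] at this
    simp [speedFn, this]

/-- The only delicate term is s² log s, which tends to zero. -/
lemma tendsto_speedFn_zero (z : ℝ) :
    Tendsto (fun s => speedFn s z) (𝓝 0) (𝓝 (speedFn 0 z)) := by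
  have h1 : Tendsto (fun s : ℝ => s ^ 2 * Real.log z) (𝓝 0) (𝓝 (0 ^ 2 * Real.log z)) :=
    (Continuous.tendsto (by fun_prop) 0)
  have h2 : Tendsto (fun s : ℝ => s * (s * Real.log s)) (𝓝 0) (𝓝 (0 * (0 * Real.log 0))) :=
    (continuous_id.mul Real.continuous_mul_log).tendsto 0
  have h3 : Tendsto (fun s : ℝ => Real.log (1 + (z - s) ^ 2) - (z ^ 2 - s ^ 2) / 2) (𝓝 0)
      (𝓝 (Real.log (1 + (z - 0) ^ 2) - (z ^ 2 - 0 ^ 2) / 2)) := by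
    refine (Continuous.sub (Continuous.log (by fun_prop) fun x => by positivity)
      (by fun_prop)).tendsto 0
  have := (h1.sub h2).add h3
  refine (this.congr fun s => ?_).trans_eq ?_
  · simp only [speedFn]; ring
  · simp [speedFn]

/-- The critical speed depends continuously on the thermal speed at zero. -/
lemma tendsto_criticalPair {ι : Type*} {l : Filter ι} {s c : ι → ℝ} {c₀ : ℝ}
    (h₀ : CriticalPair 0 c₀) (h : ∀ᶠ i in l, CriticalPair (s i) (c i))
    (hs : Tendsto s l (𝓝 0)) : Tendsto c l (𝓝 c₀) := by
  rw [tendsto_order]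
  constructor
  · intro a ha
    -- The test point has to lie in (0, c₀), where `speedFn 0` is positive. For small s i it stays
    -- positive there, whereas `speedFn (s i)` is negative beyond c i.
    have hmax : max a (c₀ / 2) < c₀ := max_lt ha (half_lt_self h₀.pos)
    have hpos : 0 < max a (c₀ / 2) := lt_max_of_lt_right (half_pos h₀.pos)
    have h1 := ((tendsto_speedFn_zero _).comp hs).eventually_const_lt (h₀.speedFn_pos hpos hmax)
    filter_upwards [h, h1] with i hi h1
    by_contra! hle
    rcases (hle.trans (le_max_left a (c₀ / 2))).eq_or_lt with heq | hlt
    · have h2 : 0 < speedFn (s i) (max a (c₀ / 2)) := h1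
      rw [← heq, hi.eq_zero] at h2
      exact lt_irrefl _ h2
    · exact lt_asymm h1 (hi.speedFn_neg hlt)
  · intro b hb
    have h1 := ((tendsto_speedFn_zero _).comp hs).eventually_lt_const (h₀.speedFn_neg hb)
    filter_upwards [h, h1, hs.eventually_lt_const (h₀.pos.trans hb)] with i hi h1 h3
    by_contra! hle
    have h2 : speedFn (s i) b < 0 := h1
    rcases hle.eq_or_lt with heq | hlt
    · rw [heq, hi.eq_zero] at h2
      exact lt_irrefl _ h2
    · exact lt_asymm h2 (hi.speedFn_pos h3 hlt)

/-! ### The fields as functions of the relative speed, and one-sided energy estimates -/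

/-- The electric potential as a function of the relative speed `u = c - v`. -/
noncomputable def potentialOf (s c u : ℝ) : ℝ :=
  (c ^ 2 - u ^ 2) / 2 + s ^ 2 * (Real.log u - Real.log c)

/-- The field energy `φ'² / 2` as a function of the relative speed `u = c - v`. -/
noncomputable def energyOf (s c u : ℝ) : ℝ :=
  Real.exp (potentialOf s c u) - 1 - c ^ 2 - s ^ 2 + c * u + s ^ 2 * c / u

/-- `u` times the charge density `ρ - exp φ`, as a function of the relative speed. -/
noncomputable def chargeOf (s c u : ℝ) : ℝ := c - u * Real.exp (potentialOf s c u)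

/-- The derivative `v'` as a function of the relative speed `u = c - v`. -/
noncomputable def slopeOf (s c u : ℝ) : ℝ := u * √(2 * energyOf s c u) / (u ^ 2 - s ^ 2)

lemma hasDerivAt_potentialOf (s c : ℝ) {u : ℝ} (hu : 0 < u) :
    HasDerivAt (potentialOf s c) (-u + s ^ 2 / u) u := by
  have h1 := (((hasDerivAt_id u).pow 2).const_sub (c ^ 2)).div_const 2
  have h2 := (((Real.hasDerivAt_log hu.ne').sub_const (Real.log c)).const_mul (s ^ 2))
  refine (h1.add h2).congr_deriv ?_
  simp only [id, Nat.cast_ofNat, Nat.add_one_sub_one, pow_one, mul_one]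
  field_simp

/-- The derivative splits into the charge and the sonic factor 1 - s²/u²; all estimates of the
energy below come from estimates of the charge. -/
lemma hasDerivAt_energyOf (s c : ℝ) {u : ℝ} (hu : 0 < u) :
    HasDerivAt (energyOf s c) (chargeOf s c u * (1 - s ^ 2 / u ^ 2)) u := by
  have h1 := ((((hasDerivAt_potentialOf s c hu).exp.sub_const 1).sub_const (c ^ 2)).sub_const
    (s ^ 2)).add ((hasDerivAt_id u).const_mul c)
  have h2 := (hasDerivAt_inv hu.ne').const_mul (s ^ 2 * c)
  refine (h1.add h2).congr_deriv ?_
  simp only [chargeOf]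
  field_simp
  ring

lemma hasDerivAt_chargeOf (s c : ℝ) {u : ℝ} (hu : 0 < u) :
    HasDerivAt (chargeOf s c) (Real.exp (potentialOf s c u) * (u ^ 2 - s ^ 2 - 1)) u := by
  have h := ((hasDerivAt_id u).mul (hasDerivAt_potentialOf s c hu).exp).const_sub c
  refine h.congr_deriv ?_
  simp only [id]
  field_simp
  ring

@[simp] lemma potentialOf_self (s c : ℝ) : potentialOf s c c = 0 := by simp [potentialOf]

lemma energyOf_self (s : ℝ) {c : ℝ} (hc : 0 < c) : energyOf s c c = 0 := by
  simp only [energyOf, potentialOf_self, Real.exp_zero]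
  field_simp
  ring

@[simp] lemma chargeOf_self (s c : ℝ) : chargeOf s c c = 0 := by simp [chargeOf]

section
variable {s c : ℝ}

/-- This is the equation for the critical speed, solved for the potential at u = s. -/
lemma CriticalPair.exp_potentialOf (h : CriticalPair s c) :
    Real.exp (potentialOf s c s) = 1 + (c - s) ^ 2 := by
  have : potentialOf s c s = Real.log (1 + (c - s) ^ 2) := by
    have := h.eq_zero
    rw [speedFn] at this
    rw [potentialOf]
    linarith
  rw [this, Real.exp_log (by positivity)]

/-- At u = s the terms other than the exponential add up to -1 - (c - s)². For s = 0 the last term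
reads 0/0 = 0, which is the intended value. -/
lemma CriticalPair.energyOf_eq_zero (h : CriticalPair s c) : energyOf s c s = 0 := by
  rw [energyOf, h.exp_potentialOf]
  rcases h.nonneg.eq_or_lt with rfl | hs
  · simp
  · field_simp
    ring

/-- The charge equals (c - s)(1 - s (c - s)) at the sonic point. -/
lemma CriticalPair.chargeOf_pos (h : CriticalPair s c) : 0 < chargeOf s c s := by
  rw [chargeOf, h.exp_potentialOf]
  have h1 := h.mul_sub_lt_one
  have h2 := h.lt
  nlinarith

lemma continuousOn_potentialOf (c : ℝ) (hs : 0 ≤ s) :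
    ContinuousOn (potentialOf s c) (Set.Ici s) := by
  rcases hs.eq_or_lt with rfl | hs
  · have : potentialOf 0 c = fun u => (c ^ 2 - u ^ 2) / 2 := by funext u; simp [potentialOf]
    rw [this]
    fun_prop
  · exact fun u hu => (hasDerivAt_potentialOf s c (hs.trans_le hu)).continuousAt.continuousWithinAt

lemma continuousOn_energyOf (c : ℝ) (hs : 0 ≤ s) :
    ContinuousOn (energyOf s c) (Set.Ici s) := by
  have h := continuousOn_potentialOf c hs
  rcases hs.eq_or_lt with rfl | hs
  · have : energyOf 0 c = fun u => Real.exp (potentialOf 0 c u) - 1 - c ^ 2 + c * u := by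
      funext u; simp [energyOf]
    rw [this]
    fun_prop
  · exact fun u hu => (hasDerivAt_energyOf s c (hs.trans_le hu)).continuousAt.continuousWithinAt

lemma continuousOn_chargeOf (c : ℝ) (hs : 0 ≤ s) :
    ContinuousOn (chargeOf s c) (Set.Ici s) := by
  have h := continuousOn_potentialOf c hs
  unfold chargeOf
  fun_prop

lemma potentialOf_le (h : CriticalPair s c) {u : ℝ} (hu : s < u) (huc : u ≤ c) :
    potentialOf s c u ≤ c * (c - u) := by
  have hu0 : 0 < u := h.nonneg.trans_lt hu
  have := Real.log_le_log hu0 huc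
  have : s ^ 2 * (Real.log u - Real.log c) ≤ 0 :=
    mul_nonpos_of_nonneg_of_nonpos (sq_nonneg s) (by linarith)
  rw [potentialOf]
  nlinarith

lemma potentialOf_nonneg (h : CriticalPair s c) {u : ℝ} (hu : s ≤ u) (huc : u ≤ c) :
    0 ≤ potentialOf s c u := by
  have hanti : AntitoneOn (potentialOf s c) (Set.Ici s) := by
    refine antitoneOn_of_deriv_nonpos (convex_Ici s) (continuousOn_potentialOf c h.nonneg)
      (fun x hx => ?_) fun x hx => ?_ <;> rw [interior_Ici] at hx
    · exact (hasDerivAt_potentialOf s c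
        (h.nonneg.trans_lt hx)).differentiableAt.differentiableWithinAt
    · have hx0 : 0 < x := h.nonneg.trans_lt hx
      rw [(hasDerivAt_potentialOf s c hx0).deriv]
      have : s ^ 2 / x ≤ x := by
        rw [div_le_iff₀ hx0]
        nlinarith [h.nonneg, Set.mem_Ioi.1 hx]
      linarith
  have := hanti (Set.mem_Ici.2 hu) (Set.mem_Ici.2 h.lt.le) huc
  rwa [potentialOf_self] at this

/-- (u - s)²/u is the model for the energy near the sonic point: its derivative is exactly the sonic
factor, so comparing the energy with a multiple of it amounts to comparing the charge with a
constant. -/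
lemma hasDerivAt_sub_sq_div (s : ℝ) {u : ℝ} (hu : 0 < u) :
    HasDerivAt (fun u => (u - s) ^ 2 / u) (1 - s ^ 2 / u ^ 2) u := by
  refine ((((hasDerivAt_id u).sub_const s).pow 2).div (hasDerivAt_id u) hu.ne').congr_deriv ?_
  simp only [id, Pi.pow_apply, Nat.cast_ofNat, Nat.add_one_sub_one, pow_one, mul_one]
  field_simp
  ring

lemma continuousOn_sub_sq_div (hs : 0 ≤ s) :
    ContinuousOn (fun u => (u - s) ^ 2 / u) (Set.Ici s) := by
  rcases hs.eq_or_lt with rfl | hs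
  · have : (fun u : ℝ => (u - 0) ^ 2 / u) = fun u => u := by
      funext u
      rcases eq_or_ne u 0 with rfl | hu
      · simp
      · field_simp
        ring
    rw [this]
    fun_prop
  · exact fun u hu => (hasDerivAt_sub_sq_div s (hs.trans_le hu)).continuousAt.continuousWithinAt

lemma one_sub_sq_div_nonneg {u : ℝ} (hs : 0 ≤ s) (hu : s < u) : 0 ≤ 1 - s ^ 2 / u ^ 2 := by
  rw [sub_nonneg, div_le_one (pow_pos (hs.trans_lt hu) 2)]
  gcongr

/-- Near the sonic point the energy is bounded above. -/
lemma energyOf_le_sonic (h : CriticalPair s c) {u : ℝ} (hu : s ≤ u) :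
    energyOf s c u ≤ c * ((u - s) ^ 2 / u) := by
  have hmono : MonotoneOn (fun u => c * ((u - s) ^ 2 / u) - energyOf s c u) (Set.Ici s) := by
    have hd : ∀ x, s < x → HasDerivAt (fun u => c * ((u - s) ^ 2 / u) - energyOf s c u)
        (c * (1 - s ^ 2 / x ^ 2) - chargeOf s c x * (1 - s ^ 2 / x ^ 2)) x := fun x hx =>
      ((hasDerivAt_sub_sq_div s (h.nonneg.trans_lt hx)).const_mul c).sub
        (hasDerivAt_energyOf s c (h.nonneg.trans_lt hx))
    refine monotoneOn_of_deriv_nonneg (convex_Ici s)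
      (((continuousOn_sub_sq_div h.nonneg).const_smul c).sub (continuousOn_energyOf c h.nonneg))
      (fun x hx => ?_) fun x hx => ?_ <;> rw [interior_Ici] at hx
    · exact (hd x hx).differentiableAt.differentiableWithinAt
    · rw [(hd x hx).deriv, ← sub_mul]
      refine mul_nonneg ?_ (one_sub_sq_div_nonneg h.nonneg hx)
      -- The charge is at most c, because c minus the charge is u exp φ ≥ 0.
      rw [chargeOf, sub_sub_cancel]
      exact mul_nonneg (h.nonneg.trans (le_of_lt hx)) (Real.exp_pos _).le
  have := hmono (Set.self_mem_Ici) (Set.mem_Ici.2 hu) hu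
  simp only [sub_self, h.energyOf_eq_zero] at this
  simp only [ne_eq, OfNat.ofNat_ne_zero, not_false_eq_true, zero_pow, zero_div, mul_zero] at this
  linarith

/-- Near the sonic point the energy is bounded below where the charge is. -/
lemma le_energyOf_sonic (h : CriticalPair s c) {u u₁ b : ℝ} (hu : s ≤ u) (hu₁ : u ≤ u₁)
    (hsub : u₁ ^ 2 ≤ 1 + s ^ 2) (hb : b ≤ chargeOf s c u₁) :
    b * ((u - s) ^ 2 / u) ≤ energyOf s c u := by
  -- As long as u² ≤ 1 + s² the charge decreases, so its value at u₁ is its minimum on [s, u₁].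
  have hanti : AntitoneOn (chargeOf s c) (Set.Icc s u₁) := by
    refine antitoneOn_of_deriv_nonpos (convex_Icc s u₁)
      ((continuousOn_chargeOf c h.nonneg).mono Set.Icc_subset_Ici_self)
      (fun x hx => ?_) fun x hx => ?_ <;> rw [interior_Icc] at hx
    · exact (hasDerivAt_chargeOf s c
        (h.nonneg.trans_lt hx.1)).differentiableAt.differentiableWithinAt
    · have hx0 : 0 < x := h.nonneg.trans_lt hx.1
      rw [(hasDerivAt_chargeOf s c hx0).deriv]
      refine mul_nonpos_of_nonneg_of_nonpos (Real.exp_pos _).le ?_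
      nlinarith [hx.2]
  have hmono : MonotoneOn (fun u => energyOf s c u - b * ((u - s) ^ 2 / u)) (Set.Icc s u₁) := by
    have hd : ∀ x, s < x → HasDerivAt (fun u => energyOf s c u - b * ((u - s) ^ 2 / u))
        (chargeOf s c x * (1 - s ^ 2 / x ^ 2) - b * (1 - s ^ 2 / x ^ 2)) x := fun x hx =>
      (hasDerivAt_energyOf s c (h.nonneg.trans_lt hx)).sub
        ((hasDerivAt_sub_sq_div s (h.nonneg.trans_lt hx)).const_mul b)
    refine monotoneOn_of_deriv_nonneg (convex_Icc s u₁)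
      (((continuousOn_energyOf c h.nonneg).sub
        ((continuousOn_sub_sq_div h.nonneg).const_smul b)).mono Set.Icc_subset_Ici_self)
      (fun x hx => ?_) fun x hx => ?_ <;> rw [interior_Icc] at hx
    · exact (hd x hx.1).differentiableAt.differentiableWithinAt
    · rw [(hd x hx.1).deriv, ← sub_mul]
      refine mul_nonneg ?_ (one_sub_sq_div_nonneg h.nonneg hx.1)
      rw [sub_nonneg]
      exact hb.trans (hanti ⟨hx.1.le, hx.2.le⟩ ⟨hu.trans hu₁, le_rfl⟩ hx.2.le)
  have := hmono ⟨le_rfl, hu.trans hu₁⟩ ⟨hu, hu₁⟩ hu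
  simp only [sub_self, h.energyOf_eq_zero] at this
  simp only [ne_eq, OfNat.ofNat_ne_zero, not_false_eq_true, zero_pow, zero_div, mul_zero,
    sub_zero] at this
  linarith

/-- Near the far field the charge is bounded below. -/
lemma neg_chargeOf_le (h : CriticalPair s c) {u : ℝ} (hu : s ≤ u) (huc : u ≤ c) :
    -chargeOf s c u ≤ c ^ 2 * Real.exp (c ^ 2) * (c - u) := by
  have hmono : MonotoneOn (fun u => c ^ 2 * Real.exp (c ^ 2) * u - chargeOf s c u)
      (Set.Icc s c) := by
    have hd : ∀ x, s < x → HasDerivAt (fun u => c ^ 2 * Real.exp (c ^ 2) * u - chargeOf s c u)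
        (c ^ 2 * Real.exp (c ^ 2) - Real.exp (potentialOf s c x) * (x ^ 2 - s ^ 2 - 1)) x :=
      fun x hx => (((hasDerivAt_id x).const_mul (c ^ 2 * Real.exp (c ^ 2))).sub
          (hasDerivAt_chargeOf s c (h.nonneg.trans_lt hx))).congr_deriv (by ring)
    refine monotoneOn_of_deriv_nonneg (convex_Icc s c)
      ((continuousOn_const.mul continuousOn_id).sub
        ((continuousOn_chargeOf c h.nonneg).mono Set.Icc_subset_Ici_self))
      (fun x hx => ?_) fun x hx => ?_ <;> rw [interior_Icc] at hx
    · exact (hd x hx.1).differentiableAt.differentiableWithinAt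
    · rw [(hd x hx.1).deriv, sub_nonneg, mul_comm (c ^ 2)]
      have hx0 : 0 < x := h.nonneg.trans_lt hx.1
      have hp : potentialOf s c x ≤ c ^ 2 := by
        have := potentialOf_le h hx.1 hx.2.le
        nlinarith [h.pos]
      have h1 : x ^ 2 - s ^ 2 - 1 ≤ c ^ 2 := by nlinarith [sq_nonneg s, hx.2]
      calc Real.exp (potentialOf s c x) * (x ^ 2 - s ^ 2 - 1)
          ≤ Real.exp (potentialOf s c x) * c ^ 2 := by gcongr
        _ ≤ Real.exp (c ^ 2) * c ^ 2 := by gcongr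
  have := hmono ⟨hu, huc⟩ ⟨h.lt.le, le_rfl⟩ huc
  simp only [chargeOf_self] at this
  linarith

/-- The sonic factor is at most one, so the linear bound of `neg_chargeOf_le` integrates from u to
c, where the energy vanishes, to a quadratic one. -/
lemma energyOf_le_far (h : CriticalPair s c) {u : ℝ} (hu : s ≤ u) (huc : u ≤ c) :
    energyOf s c u ≤ c ^ 2 * Real.exp (c ^ 2) * (c - u) ^ 2 := by
  set K := c ^ 2 * Real.exp (c ^ 2) with hK
  have hK0 : 0 < K := by have := h.pos; positivity
  have hmono : MonotoneOn (fun u => energyOf s c u - K * (c - u) ^ 2) (Set.Icc s c) := by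
    have hd : ∀ x, s < x → HasDerivAt (fun u => energyOf s c u - K * (c - u) ^ 2)
        (chargeOf s c x * (1 - s ^ 2 / x ^ 2) + K * (2 * (c - x))) x :=
      fun x hx => by
        refine ((hasDerivAt_energyOf s c (h.nonneg.trans_lt hx)).sub
          ((((hasDerivAt_id x).const_sub c).pow 2).const_mul K)).congr_deriv ?_
        simp
    refine monotoneOn_of_deriv_nonneg (convex_Icc s c)
      (((continuousOn_energyOf c h.nonneg).mono Set.Icc_subset_Ici_self).sub (by fun_prop))
      (fun x hx => ?_) fun x hx => ?_ <;> rw [interior_Icc] at hx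
    · exact (hd x hx.1).differentiableAt.differentiableWithinAt
    · rw [(hd x hx.1).deriv]
      have h1 := neg_chargeOf_le h hx.1.le hx.2.le
      rw [← hK] at h1
      have h2 := one_sub_sq_div_nonneg h.nonneg hx.1
      have h3 : 1 - s ^ 2 / x ^ 2 ≤ 1 := by
        have : 0 ≤ s ^ 2 / x ^ 2 := by positivity
        linarith
      have h4 : 0 ≤ K * (c - x) := mul_nonneg hK0.le (by linarith [hx.2])
      nlinarith
  have := hmono ⟨hu, huc⟩ ⟨h.lt.le, le_rfl⟩ huc
  simp only [energyOf_self s h.pos] at this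
  simp only [sub_self, ne_eq, OfNat.ofNat_ne_zero, not_false_eq_true, zero_pow, mul_zero] at this
  linarith

/-- Near the far field the energy is bounded below. -/
lemma le_energyOf_far (h : CriticalPair s c) {u u₂ d : ℝ} (hu : u₂ ≤ u) (huc : u ≤ c)
    (hu₂ : s < u₂) (hd : 0 ≤ d) (hsup : 1 + s ^ 2 + d ≤ u₂ ^ 2) :
    d * (1 - s ^ 2 / u₂ ^ 2) / 2 * (c - u) ^ 2 ≤ energyOf s c u := by
  have hu₂0 : 0 < u₂ := h.nonneg.trans_lt hu₂
  have hu₂c : u₂ ≤ c := hu.trans huc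
  -- The potential is nonnegative and x² - s² - 1 ≥ d beyond u₂, so the charge grows with slope at
  -- least d up to its zero at c.
  have hcharge : ∀ x, u₂ ≤ x → x ≤ c → chargeOf s c x ≤ - (d * (c - x)) := by
    have hmono : MonotoneOn (fun u => chargeOf s c u - d * u) (Set.Icc u₂ c) := by
      have hder : ∀ x, u₂ ≤ x → HasDerivAt (fun u => chargeOf s c u - d * u)
          (Real.exp (potentialOf s c x) * (x ^ 2 - s ^ 2 - 1) - d) x := fun x hx =>
        ((hasDerivAt_chargeOf s c (hu₂0.trans_le hx)).sub
          ((hasDerivAt_id x).const_mul d)).congr_deriv (by ring)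
      refine monotoneOn_of_deriv_nonneg (convex_Icc u₂ c)
        (fun x hx => (hder x hx.1).continuousAt.continuousWithinAt)
        (fun x hx => ?_) fun x hx => ?_ <;> rw [interior_Icc] at hx
      · exact (hder x hx.1.le).differentiableAt.differentiableWithinAt
      · rw [(hder x hx.1.le).deriv]
        have h1 : 1 ≤ Real.exp (potentialOf s c x) :=
          Real.one_le_exp (potentialOf_nonneg h (hu₂.trans hx.1).le hx.2.le)
        have h2 : d ≤ x ^ 2 - s ^ 2 - 1 := by nlinarith [hx.1]
        nlinarith
    intro x hx hxc
    have := hmono ⟨hx, hxc⟩ ⟨hu₂c, le_rfl⟩ hxc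
    simp only [chargeOf_self] at this
    linarith
  set a := 1 - s ^ 2 / u₂ ^ 2 with ha
  have ha0 : 0 ≤ a := one_sub_sq_div_nonneg h.nonneg hu₂
  have hanti : AntitoneOn (fun u => energyOf s c u - d * a / 2 * (c - u) ^ 2)
      (Set.Icc u₂ c) := by
    have hder : ∀ x, u₂ ≤ x → HasDerivAt (fun u => energyOf s c u - d * a / 2 * (c - u) ^ 2)
        (chargeOf s c x * (1 - s ^ 2 / x ^ 2) + d * a * (c - x)) x := fun x hx => by
      refine ((hasDerivAt_energyOf s c (hu₂0.trans_le hx)).sub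
          ((((hasDerivAt_id x).const_sub c).pow 2).const_mul (d * a / 2))).congr_deriv ?_
      simp
      ring
    refine antitoneOn_of_deriv_nonpos (convex_Icc u₂ c)
      (fun x hx => (hder x hx.1).continuousAt.continuousWithinAt)
      (fun x hx => ?_) fun x hx => ?_ <;> rw [interior_Icc] at hx
    · exact (hder x hx.1.le).differentiableAt.differentiableWithinAt
    · rw [(hder x hx.1.le).deriv]
      have h1 := hcharge x hx.1.le hx.2.le
      have h2 : a ≤ 1 - s ^ 2 / x ^ 2 := by
        rw [ha]
        gcongr
        exact hx.1.le
      have h3 : 0 ≤ d * (c - x) := mul_nonneg hd (by linarith [hx.2])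
      nlinarith
  have := hanti ⟨hu, huc⟩ ⟨hu₂c, le_rfl⟩ huc
  simp only [energyOf_self s h.pos] at this
  simp only [sub_self, ne_eq, OfNat.ofNat_ne_zero, not_false_eq_true, zero_pow, mul_zero] at this
  linarith

end

/-! ### Two-sided bounds on the slope, uniform near a critical pair -/

section
variable {s c : ℝ}

lemma continuousAt_potentialOf {s c u : ℝ} (hc : 0 < c) (hu : 0 < u) :
    ContinuousAt (fun q : ℝ × ℝ × ℝ => potentialOf q.1 q.2.1 q.2.2) (s, c, u) := by
  have h1 : ContinuousAt (fun q : ℝ × ℝ × ℝ => Real.log q.2.2) (s, c, u) :=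
    ContinuousAt.log (by fun_prop) hu.ne'
  have h2 : ContinuousAt (fun q : ℝ × ℝ × ℝ => Real.log q.2.1) (s, c, u) :=
    ContinuousAt.log (by fun_prop) hc.ne'
  unfold potentialOf
  fun_prop

lemma continuousAt_energyOf {s c u : ℝ} (hc : 0 < c) (hu : 0 < u) :
    ContinuousAt (fun q : ℝ × ℝ × ℝ => energyOf q.1 q.2.1 q.2.2) (s, c, u) := by
  have h1 := continuousAt_potentialOf (s := s) hc hu
  have h2 : ContinuousAt (fun q : ℝ × ℝ × ℝ => q.1 ^ 2 * q.2.1 / q.2.2) (s, c, u) :=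
    ContinuousAt.div (by fun_prop) (by fun_prop) hu.ne'
  unfold energyOf
  fun_prop

lemma continuousAt_chargeOf {s c u : ℝ} (hc : 0 < c) (hu : 0 < u) :
    ContinuousAt (fun q : ℝ × ℝ × ℝ => chargeOf q.1 q.2.1 q.2.2) (s, c, u) := by
  have h1 := continuousAt_potentialOf (s := s) hc hu
  unfold chargeOf
  fun_prop

lemma continuousAt_slopeOf {s c u : ℝ} (hc : 0 < c) (hs : 0 ≤ s) (hu : s < u) :
    ContinuousAt (fun q : ℝ × ℝ × ℝ => slopeOf q.1 q.2.1 q.2.2) (s, c, u) := by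
  have h1 := continuousAt_energyOf (s := s) hc (hs.trans_lt hu)
  unfold slopeOf
  refine ContinuousAt.div (by fun_prop) (by fun_prop) ?_
  have : 0 < u ^ 2 - s ^ 2 := by nlinarith
  exact this.ne'

lemma sub_sq_div_le {u : ℝ} (hs : 0 ≤ s) (hu : s < u) : (u - s) ^ 2 / u ≤ u := by
  rw [div_le_iff₀ (hs.trans_lt hu)]
  nlinarith

/-- The interval is cut at u₁ < √(1 + s₀²) < u₂. Below u₁ the charge is bounded below by a positive
constant, beyond u₂ the far-field estimate applies, and on the compact middle part the energy has a
positive minimum. Each bound survives a small change of (s, c). Positivity of the energy is assumed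
here; later the wave itself provides it. -/
lemma exists_energyOf_lower_bound {s₀ c₀ : ℝ} (h₀ : CriticalPair s₀ c₀)
    (hpos : ∀ u, s₀ < u → u < c₀ → 0 < energyOf s₀ c₀ u) :
    ∃ m, 0 < m ∧ ∀ᶠ q : ℝ × ℝ in 𝓝 (s₀, c₀), CriticalPair q.1 q.2 →
      ∀ u, q.1 < u → u < q.2 →
        m * ((q.2 - u) ^ 2 * ((u - q.1) ^ 2 / u)) ≤ energyOf q.1 q.2 u := by
  obtain ⟨u₂, hu₂, hu₂c⟩ := exists_between h₀.sqrt_lt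
  have hu₂0 : 0 < u₂ := (Real.sqrt_nonneg _).trans_lt hu₂
  have hu₂s : s₀ < u₂ := (lt_sqrt_one_add_sq s₀).trans hu₂
  have hu₂sq : 1 + s₀ ^ 2 < u₂ ^ 2 := (Real.sqrt_lt' hu₂0).1 hu₂
  obtain ⟨u₁, hu₁c, hu₁⟩ : ∃ u₁, 0 < chargeOf s₀ c₀ u₁ ∧ u₁ ∈ Set.Ioo s₀ (√(1 + s₀ ^ 2)) := by
    have hcont : Tendsto (chargeOf s₀ c₀) (𝓝[>] s₀) (𝓝 (chargeOf s₀ c₀ s₀)) :=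
      ((continuousOn_chargeOf c₀ h₀.nonneg) s₀ Set.self_mem_Ici).mono Set.Ioi_subset_Ici_self
    exact ((hcont.eventually_const_lt h₀.chargeOf_pos).and
      (Ioo_mem_nhdsGT (lt_sqrt_one_add_sq s₀))).exists
  have hu₁0 : 0 < u₁ := h₀.nonneg.trans_lt hu₁.1
  have hu₁sq : u₁ ^ 2 < 1 + s₀ ^ 2 := (Real.lt_sqrt hu₁0.le).1 hu₁.2
  obtain ⟨w, hw, hmin⟩ := isCompact_Icc.exists_isMinOn
    (Set.nonempty_Icc.2 (hu₁.2.trans hu₂).le)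
    (f := energyOf s₀ c₀) ((continuousOn_energyOf c₀ h₀.nonneg).mono
      fun x hx => hu₁.1.le.trans hx.1)
  set e := energyOf s₀ c₀ w with he
  have he0 : 0 < e := hpos w (hu₁.1.trans_le hw.1) (hw.2.trans_lt hu₂c)
  set b := chargeOf s₀ c₀ u₁ with hb
  set d := (u₂ ^ 2 - 1 - s₀ ^ 2) / 2 with hd
  have hd0 : 0 < d := by rw [hd]; linarith
  set A := c₀ + 1 with hA
  have hA0 : 0 < A := by have := h₀.pos; positivity
  -- One constant per zone, halved to leave room for perturbation where necessary. Dividing by A² or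
  -- A pays for the factors (c - u)² ≤ A² and (u - s)²/u ≤ A that the bound of that zone lacks.
  refine ⟨min (b / 2 / A ^ 2) (min (e / 2 / (A ^ 2 * A)) (d * (1 / u₂ ^ 2) / 2 / A)), ?_, ?_⟩
  · refine lt_min (by positivity) (lt_min (by positivity) (by positivity))
  have ev1 : ∀ᶠ q : ℝ × ℝ in 𝓝 (s₀, c₀), q.2 < A :=
    continuousAt_snd.eventually_lt_const (by simp [hA])
  have ev2 : ∀ᶠ q : ℝ × ℝ in 𝓝 (s₀, c₀), u₁ ^ 2 < 1 + q.1 ^ 2 := by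
    have : ContinuousAt (fun q : ℝ × ℝ => 1 + q.1 ^ 2) (s₀, c₀) := by fun_prop
    exact this.eventually_const_lt hu₁sq
  have ev3 : ∀ᶠ q : ℝ × ℝ in 𝓝 (s₀, c₀), 1 + q.1 ^ 2 + d < u₂ ^ 2 := by
    have : ContinuousAt (fun q : ℝ × ℝ => 1 + q.1 ^ 2 + d) (s₀, c₀) := by fun_prop
    exact this.eventually_lt_const (by simp only [hd]; linarith)
  have ev4 : ∀ᶠ q : ℝ × ℝ in 𝓝 (s₀, c₀), b / 2 < chargeOf q.1 q.2 u₁ := by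
    have h1 : ContinuousAt (fun q : ℝ × ℝ => (q.1, q.2, u₁)) (s₀, c₀) := by fun_prop
    have : ContinuousAt (fun q : ℝ × ℝ => chargeOf q.1 q.2 u₁) (s₀, c₀) :=
      ContinuousAt.comp (g := fun q : ℝ × ℝ × ℝ => chargeOf q.1 q.2.1 q.2.2)
        (f := fun q : ℝ × ℝ => (q.1, q.2, u₁))
        (continuousAt_chargeOf (s := s₀) h₀.pos hu₁0) h1
    exact this.eventually_const_lt (half_lt_self hu₁c)
  have ev5 : ∀ᶠ q : ℝ × ℝ in 𝓝 (s₀, c₀), ∀ u ∈ Set.Icc u₁ u₂, e / 2 < energyOf q.1 q.2 u := by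
    refine isCompact_Icc.eventually_forall_of_forall_eventually fun u hu => ?_
    have h1 : ContinuousAt (fun q : (ℝ × ℝ) × ℝ => (q.1.1, q.1.2, q.2)) ((s₀, c₀), u) := by
      fun_prop
    have : ContinuousAt (fun q : (ℝ × ℝ) × ℝ => energyOf q.1.1 q.1.2 q.2) ((s₀, c₀), u) :=
      ContinuousAt.comp (g := fun q : ℝ × ℝ × ℝ => energyOf q.1 q.2.1 q.2.2)
        (f := fun q : (ℝ × ℝ) × ℝ => (q.1.1, q.1.2, q.2))
        (continuousAt_energyOf (s := s₀) h₀.pos (hu₁0.trans_le hu.1)) h1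
    exact this.eventually_const_lt ((half_lt_self he0).trans_le (hmin hu))
  filter_upwards [ev1, ev2, ev3, ev4, ev5] with q h1 h2 h3 h4 h5 hq u hu huc
  have hu0 : 0 < u := hq.nonneg.trans_lt hu
  have hD0 : 0 ≤ (u - q.1) ^ 2 / u := by positivity
  have hD : (u - q.1) ^ 2 / u ≤ A := (sub_sq_div_le hq.nonneg hu).trans (huc.trans h1).le
  have hC : (q.2 - u) ^ 2 ≤ A ^ 2 := by
    have := huc.le
    gcongr
    linarith
  rcases le_total u u₁ with hle | hle
  · refine le_trans ?_ (le_energyOf_sonic hq hu.le hle h2.le h4.le)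
    calc _ ≤ b / 2 / A ^ 2 * (A ^ 2 * ((u - q.1) ^ 2 / u)) := by
          gcongr
          exact min_le_left _ _
      _ = _ := by field_simp
  rcases le_total u u₂ with hle2 | hle2
  · refine le_trans ?_ (h5 u ⟨hle, hle2⟩).le
    calc _ ≤ e / 2 / (A ^ 2 * A) * (A ^ 2 * A) := by
          gcongr
          exact (min_le_right _ _).trans (min_le_left _ _)
      _ = _ := by field_simp
  · have hq2 : q.1 < u₂ := by nlinarith [hq.nonneg]
    refine le_trans ?_ (le_energyOf_far hq hle2 huc.le hq2 hd0.le h3.le)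
    have h6 : 1 / u₂ ^ 2 ≤ 1 - q.1 ^ 2 / u₂ ^ 2 := by
      rw [div_le_iff₀ (by positivity), sub_mul, div_mul_cancel₀ _ (by positivity)]
      linarith
    calc _ ≤ d * (1 / u₂ ^ 2) / 2 / A * ((q.2 - u) ^ 2 * A) := by
          gcongr
          exact (min_le_right _ _).trans (min_le_right _ _)
      _ = d * (1 / u₂ ^ 2) / 2 * (q.2 - u) ^ 2 := by field_simp
      _ ≤ _ := by gcongr

/-- The sonic and the far-field upper bounds each lack one factor. Left of a the factor (c - u)² is
at least (b - a)², and right of a the factor (u - s)²/u is at least (a - a')²/A. -/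
lemma exists_energyOf_upper_bound {s₀ c₀ : ℝ} (h₀ : CriticalPair s₀ c₀) :
    ∃ M, 0 < M ∧ ∀ᶠ q : ℝ × ℝ in 𝓝 (s₀, c₀), CriticalPair q.1 q.2 →
      ∀ u, q.1 < u → u < q.2 →
        energyOf q.1 q.2 u ≤ M * ((q.2 - u) ^ 2 * ((u - q.1) ^ 2 / u)) := by
  obtain ⟨a, ha, hac⟩ := exists_between h₀.lt
  obtain ⟨a', ha', haa⟩ := exists_between ha
  obtain ⟨b, hab, hbc⟩ := exists_between hac
  set A := c₀ + 1 with hA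
  have hA0 : 0 < A := by have := h₀.pos; positivity
  have h1 : 0 < b - a := sub_pos.2 hab
  have h2 : 0 < a - a' := sub_pos.2 haa
  refine ⟨max (A / (b - a) ^ 2) (A ^ 2 * Real.exp (A ^ 2) * A / (a - a') ^ 2), by positivity, ?_⟩
  have ev1 : ∀ᶠ q : ℝ × ℝ in 𝓝 (s₀, c₀), q.2 < A :=
    continuousAt_snd.eventually_lt_const (by simp [hA])
  have ev2 : ∀ᶠ q : ℝ × ℝ in 𝓝 (s₀, c₀), b < q.2 := continuousAt_snd.eventually_const_lt hbc
  have ev3 : ∀ᶠ q : ℝ × ℝ in 𝓝 (s₀, c₀), q.1 < a' := continuousAt_fst.eventually_lt_const ha'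
  filter_upwards [ev1, ev2, ev3] with q e1 e2 e3 hq u hu huc
  have hu0 : 0 < u := hq.nonneg.trans_lt hu
  have hD0 : 0 ≤ (u - q.1) ^ 2 / u := by positivity
  have hq0 := hq.pos
  rcases le_total u a with hle | hle
  · refine (energyOf_le_sonic hq hu.le).trans ?_
    calc q.2 * ((u - q.1) ^ 2 / u) ≤ A * ((u - q.1) ^ 2 / u) := by gcongr
      _ = A / (b - a) ^ 2 * ((b - a) ^ 2 * ((u - q.1) ^ 2 / u)) := by field_simp
      _ ≤ _ := by
          gcongr
          exact le_max_left _ _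
  · refine (energyOf_le_far hq hu.le huc.le).trans ?_
    calc q.2 ^ 2 * Real.exp (q.2 ^ 2) * (q.2 - u) ^ 2
        ≤ A ^ 2 * Real.exp (A ^ 2) * (q.2 - u) ^ 2 := by gcongr
      _ = A ^ 2 * Real.exp (A ^ 2) * A / (a - a') ^ 2 * ((q.2 - u) ^ 2 * ((a - a') ^ 2 / A)) := by
          field_simp
      _ ≤ _ := by
          gcongr
          · exact le_max_right _ _
          · exact (huc.trans e1).le

/-- The slope is comparable to `(c - u) / √u`, uniformly near a critical pair. -/
def SlopeBounds (k K s c : ℝ) : Prop :=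
  ∀ u, s < u → u < c →
    k * ((c - u) / √u) ≤ slopeOf s c u ∧ slopeOf s c u ≤ K * ((c - u) / √u)

lemma sqrt_energy_bound {u m : ℝ} (hs : 0 ≤ s) (hu : s < u) (huc : u < c) (hm : 0 ≤ m) :
    √(2 * (m * ((c - u) ^ 2 * ((u - s) ^ 2 / u)))) = √(2 * m) * ((c - u) * ((u - s) / √u)) := by
  have h1 : 0 ≤ (c - u) * ((u - s) / √u) :=
    mul_nonneg (by linarith) (div_nonneg (by linarith) (Real.sqrt_nonneg _))
  rw [← Real.sqrt_sq h1, ← Real.sqrt_mul (by positivity)]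
  congr 1
  rw [mul_pow, div_pow, Real.sq_sqrt (hs.trans hu.le)]
  ring

/-- The root of the energy contributes (c - u)(u - s)/√u. Its zero at s cancels against u² - s² = (u
- s)(u + s), and u/(u + s) lies between 1/2 and 1; this is why nothing degenerates as s → 0. -/
lemma exists_slopeBounds {s₀ c₀ : ℝ} (h₀ : CriticalPair s₀ c₀)
    (hpos : ∀ u, s₀ < u → u < c₀ → 0 < energyOf s₀ c₀ u) :
    ∃ k K, 0 < k ∧ 0 < K ∧ ∀ᶠ q : ℝ × ℝ in 𝓝 (s₀, c₀), CriticalPair q.1 q.2 →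
      SlopeBounds k K q.1 q.2 := by
  obtain ⟨m, hm, hml⟩ := exists_energyOf_lower_bound h₀ hpos
  obtain ⟨M, hM, hMu⟩ := exists_energyOf_upper_bound h₀
  refine ⟨√(2 * m) / 2, √(2 * M), by positivity, by positivity, ?_⟩
  filter_upwards [hml, hMu] with q h1 h2 hq u hu huc
  have hu0 : 0 < u := hq.nonneg.trans_lt hu
  have h3 := Real.sqrt_le_sqrt (mul_le_mul_of_nonneg_left (h1 hq u hu huc) zero_le_two)
  have h4 := Real.sqrt_le_sqrt (mul_le_mul_of_nonneg_left (h2 hq u hu huc) zero_le_two)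
  rw [sqrt_energy_bound hq.nonneg hu huc hm.le] at h3
  rw [sqrt_energy_bound hq.nonneg hu huc hM.le] at h4
  have hus : 0 < u - q.1 := sub_pos.2 hu
  have hus' : 0 < u + q.1 := by linarith [hq.nonneg]
  have hcu : 0 < q.2 - u := sub_pos.2 huc
  have hsq : 0 < √u := Real.sqrt_pos.2 hu0
  have hfac : u ^ 2 - q.1 ^ 2 = (u - q.1) * (u + q.1) := by ring
  rw [slopeOf, hfac]
  constructor
  · rw [le_div_iff₀ (by positivity)]
    calc √(2 * m) / 2 * ((q.2 - u) / √u) * ((u - q.1) * (u + q.1))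
        ≤ √(2 * m) / 2 * ((q.2 - u) / √u) * ((u - q.1) * (u + u)) := by
          have := hu.le
          gcongr
      _ = u * (√(2 * m) * ((q.2 - u) * ((u - q.1) / √u))) := by ring
      _ ≤ _ := by gcongr
  · rw [div_le_iff₀ (by positivity)]
    calc u * √(2 * energyOf q.1 q.2 u)
        ≤ u * (√(2 * M) * ((q.2 - u) * ((u - q.1) / √u))) := by gcongr
      _ = √(2 * M) * ((q.2 - u) / √u) * ((u - q.1) * u) := by ring
      _ ≤ _ := by
          have := hq.nonneg
          gcongr
          linarith

end

/-! ### Reduction of the travelling wave equations to first order -/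

lemma eq_of_hasDerivAt_zero_of_tendsto_atBot {f : ℝ → ℝ} {L : ℝ}
    (hf : ∀ x < 0, HasDerivAt f 0 x) (hL : Tendsto f atBot (𝓝 L)) {x : ℝ} (hx : x < 0) :
    f x = L := by
  have hconst : ∀ y < 0, f y = f x := fun y hy =>
    isOpen_Iio.is_const_of_deriv_eq_zero isPreconnected_Iio
      (fun z hz => (hf z hz).differentiableAt.differentiableWithinAt)
      (fun z hz => (hf z hz).deriv) hy hx
  refine tendsto_nhds_unique (tendsto_const_nhds.congr' ?_) hL
  filter_upwards [Iio_mem_atBot (0 : ℝ)] with y hy using (hconst y hy).symm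

lemma lt_of_deriv_pos_of_tendsto_atBot {f : ℝ → ℝ} {L : ℝ}
    (hf : ∀ x < 0, DifferentiableAt ℝ f x) (hf' : ∀ x < 0, 0 < deriv f x)
    (hL : Tendsto f atBot (𝓝 L)) {x : ℝ} (hx : x < 0) : L < f x := by
  have hmono : StrictMonoOn f (Set.Iio 0) :=
    strictMonoOn_of_deriv_pos (convex_Iio 0)
      (fun y hy => (hf y hy).continuousAt.continuousWithinAt)
      fun y hy => hf' y (by simpa using hy)
  have h1 : f (x - 1) < f x := hmono (by simp; linarith) hx (by linarith)
  refine lt_of_le_of_lt (le_of_tendsto hL ?_) h1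
  filter_upwards [Iic_mem_atBot (x - 1)] with y hy
  exact hmono.monotoneOn (lt_of_le_of_lt (Set.mem_Iic.1 hy) (by linarith)) (by simp; linarith) hy

/-- If `f` and `f'` both have a limit at `-∞`, then the limit of `f'` is zero. -/
lemma limit_deriv_eq_zero_of_tendsto_atBot {f f' : ℝ → ℝ} {L M : ℝ}
    (hf : ∀ x < 0, HasDerivAt f (f' x) x)
    (hL : Tendsto f atBot (𝓝 L)) (hM : Tendsto f' atBot (𝓝 M)) : M = 0 := by
  have hmvt : ∀ x : ℝ, x < 0 → ∃ y, y < x ∧ f' y = f x - f (x - 1) := fun x hx => by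
    obtain ⟨y, hy, hy'⟩ := exists_hasDerivAt_eq_slope f f' (sub_one_lt x)
      (fun z hz => (hf z (hz.2.trans_lt hx)).continuousAt.continuousWithinAt)
      (fun z hz => hf z (hz.2.trans hx))
    exact ⟨y, hy.2, by rw [hy']; simp⟩
  choose! y hy hy' using hmvt
  have hy_tendsto : Tendsto y atBot atBot := by
    refine tendsto_atBot_mono' _ ?_ tendsto_id
    filter_upwards [Iio_mem_atBot (0 : ℝ)] with x hx using (hy x hx).le
  have h1 : Tendsto (fun x => f x - f (x - 1)) atBot (𝓝 (L - L)) :=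
    hL.sub (hL.comp (tendsto_atBot_add_const_right _ (-1) tendsto_id))
  rw [sub_self] at h1
  refine tendsto_nhds_unique (hM.comp hy_tendsto) (h1.congr' ?_)
  filter_upwards [Iio_mem_atBot (0 : ℝ)] with x hx using (hy' x hx).symm

lemma not_distinctOneSidedDerivs {f : ℝ → ℝ} {a : ℝ} (hf : HasDerivAt f a 0) :
    ¬ DistinctOneSidedDerivs f := by
  rintro ⟨l, r, hlr, hl, hr⟩
  have h1 : Tendsto (fun ξ : ℝ => (((f ξ - f 0) / ξ : ℝ) : EReal)) (𝓝[≠] 0) (𝓝 (a : EReal)) := by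
    have := (hasDerivAt_iff_tendsto_slope.1 hf)
    refine ((continuous_coe_real_ereal.tendsto a).comp this).congr fun x => ?_
    simp [slope_def_field]
  apply hlr
  rw [tendsto_nhds_unique hl (h1.mono_left (nhdsWithin_mono _ fun x hx => (ne_of_lt hx))),
    tendsto_nhds_unique hr (h1.mono_left (nhdsWithin_mono _ fun x hx => (ne_of_gt hx)))]

/-- A peaked solitary wave in terms of the relative speed `c - v`, with its fields reduced to
first order equations. -/
structure ReducedWave (s c : ℝ) (ρ v φ : ℝ → ℝ) : Prop where
  pair : CriticalPair s c
  lt_rel : ∀ x < 0, s < c - v x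
  rel_lt : ∀ x < 0, c - v x < c
  rho_eq : ∀ x < 0, ρ x = c / (c - v x)
  phi_eq : ∀ x < 0, φ x = potentialOf s c (c - v x)
  energy_pos : ∀ x < 0, 0 < energyOf s c (c - v x)
  phi_deriv : ∀ x < 0, HasDerivAt φ (√(2 * energyOf s c (c - v x))) x
  v_deriv : ∀ x < 0, HasDerivAt v (slopeOf s c (c - v x)) x
  v_zero : v 0 = c - s
  v_far : Tendsto v atBot (𝓝 0)
  phi_far : Tendsto φ atBot (𝓝 0)
  phi_deriv_far : Tendsto (deriv φ) atBot (𝓝 0)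
  v_cont : Continuous v
  phi_cont_diff : ContDiff ℝ 1 φ
  phi_deriv_zero : deriv φ 0 = 0
  phi_deriv2 : ∀ x ≠ 0, HasDerivAt (deriv φ) (Real.exp (φ x) - ρ x) x
  rho_cont : ContinuousOn ρ {0}ᶜ
  rho_even : ∀ x ≠ 0, ρ (-x) = ρ x
  v_even : ∀ x, v (-x) = v x
  phi_even : ∀ x, φ (-x) = φ x

section
variable {κ c : ℝ} {ρ v φ : ℝ → ℝ}

namespace IsPeakedSolitaryWave

lemma hasDerivAt_rho (h : IsPeakedSolitaryWave κ c ρ v φ) {x : ℝ} (hx : x ≠ 0) :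
    HasDerivAt ρ (deriv ρ x) x :=
  ((h.rho_smooth.differentiableOn one_ne_zero).differentiableAt
    (isOpen_compl_singleton.mem_nhds hx)).hasDerivAt

lemma hasDerivAt_v (h : IsPeakedSolitaryWave κ c ρ v φ) {x : ℝ} (hx : x ≠ 0) :
    HasDerivAt v (deriv v x) x :=
  ((h.v_smooth.differentiableOn one_ne_zero).differentiableAt
    (isOpen_compl_singleton.mem_nhds hx)).hasDerivAt

lemma hasDerivAt_phi (h : IsPeakedSolitaryWave κ c ρ v φ) {x : ℝ} (hx : x ≠ 0) :
    HasDerivAt φ (deriv φ x) x :=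
  ((h.phi_smooth.differentiableOn two_ne_zero).differentiableAt
    (isOpen_compl_singleton.mem_nhds hx)).hasDerivAt

lemma hasDerivAt_deriv_phi (h : IsPeakedSolitaryWave κ c ρ v φ) {x : ℝ} (hx : x ≠ 0) :
    HasDerivAt (deriv φ) (Real.exp (φ x) - ρ x) x := by
  have h1 : ContDiffOn ℝ 1 (deriv φ) {0}ᶜ :=
    ((contDiffOn_succ_iff_deriv_of_isOpen (n := 1) isOpen_compl_singleton).1 h.phi_smooth).2.2
  have h2 := ((h1.differentiableOn one_ne_zero).differentiableAt
    (isOpen_compl_singleton.mem_nhds hx)).hasDerivAt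
  refine h2.congr_deriv ?_
  have := h.poisson x hx
  linarith

lemma v_even' (h : IsPeakedSolitaryWave κ c ρ v φ) (x : ℝ) : v (-x) = v x := by
  rcases eq_or_ne x 0 with rfl | hx
  · simp
  · exact (h.v_even x hx).symm

lemma phi_even' (h : IsPeakedSolitaryWave κ c ρ v φ) (x : ℝ) : φ (-x) = φ x := by
  rcases eq_or_ne x 0 with rfl | hx
  · simp
  · exact (h.phi_even x hx).symm

lemma mass_eq (h : IsPeakedSolitaryWave κ c ρ v φ) {x : ℝ} (hx : x ≠ 0) :
    deriv ρ x * (c - v x) = ρ x * deriv v x := by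
  have h1 := h.mass x hx
  have h2 : deriv (fun η => ρ η * v η) x = deriv ρ x * v x + ρ x * deriv v x :=
    ((h.hasDerivAt_rho hx).mul (h.hasDerivAt_v hx)).deriv
  linarith

/-- The flux is constant by the mass equation, and its far-field value is c. -/
lemma rho_mul (h : IsPeakedSolitaryWave κ c ρ v φ) {x : ℝ} (hx : x < 0) :
    ρ x * (c - v x) = c := by
  refine eq_of_hasDerivAt_zero_of_tendsto_atBot (f := fun x => ρ x * (c - v x)) (fun y hy => ?_)
    ?_ hx
  · refine ((h.hasDerivAt_rho hy.ne).mul ((h.hasDerivAt_v hy.ne).const_sub c)).congr_deriv ?_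
    rw [h.mass_eq hy.ne]
    ring
  · have := h.rho_far.mul (h.v_far.const_sub c)
    simpa using this

lemma one_lt_rho (h : IsPeakedSolitaryWave κ c ρ v φ) {x : ℝ} (hx : x < 0) : 1 < ρ x :=
  lt_of_deriv_pos_of_tendsto_atBot (fun _ hy => (h.hasDerivAt_rho hy.ne).differentiableAt)
    h.rho_mono h.rho_far hx

lemma v_pos (h : IsPeakedSolitaryWave κ c ρ v φ) {x : ℝ} (hx : x < 0) : 0 < v x :=
  lt_of_deriv_pos_of_tendsto_atBot (fun _ hy => (h.hasDerivAt_v hy.ne).differentiableAt)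
    h.v_mono h.v_far hx

lemma rel_pos (h : IsPeakedSolitaryWave κ c ρ v φ) (hc : 0 < c) {x : ℝ} (hx : x < 0) :
    0 < c - v x := by
  have h1 := h.rho_mul hx
  have h2 := h.one_lt_rho hx
  by_contra! hle
  nlinarith

lemma rho_eq (h : IsPeakedSolitaryWave κ c ρ v φ) (hc : 0 < c) {x : ℝ} (hx : x < 0) :
    ρ x = c / (c - v x) := by
  rw [eq_div_iff (h.rel_pos hc hx).ne', h.rho_mul hx]

lemma deriv_phi_eq (h : IsPeakedSolitaryWave κ c ρ v φ) (hc : 0 < c) {x : ℝ} (hx : x < 0) :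
    deriv φ x = deriv v x * ((c - v x) - κ / (c - v x)) := by
  have h1 := h.mass_eq hx.ne
  have h2 := h.momentum x hx.ne
  have h3 : 0 < ρ x := zero_lt_one.trans (h.one_lt_rho hx)
  have h4 := h.rel_pos hc hx
  have h5 : deriv ρ x = ρ x * deriv v x / (c - v x) := by rw [eq_div_iff h4.ne', h1]
  rw [h5] at h2
  have h6 : ρ x * deriv φ x = ρ x * (deriv v x * ((c - v x) - κ / (c - v x))) := by
    have e : κ * (ρ x * deriv v x / (c - v x)) = ρ x * (deriv v x * (κ / (c - v x))) := by ring
    rw [e] at h2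
    linear_combination h2
  exact mul_left_cancel₀ h3.ne' h6

/-- Bernoulli's law: the two sides have the same derivative and both vanish in the far field. -/
lemma phi_eq (h : IsPeakedSolitaryWave κ c ρ v φ) (hκ : 0 ≤ κ) (hc : 0 < c) {x : ℝ}
    (hx : x < 0) : φ x = potentialOf (√κ) c (c - v x) := by
  have h1 : φ x - potentialOf (√κ) c (c - v x) = 0 := by
    refine eq_of_hasDerivAt_zero_of_tendsto_atBot
      (f := fun x => φ x - potentialOf (√κ) c (c - v x)) (fun y hy => ?_) ?_ hx
    · refine ((h.hasDerivAt_phi hy.ne).sub ((hasDerivAt_potentialOf (√κ) c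
        (h.rel_pos hc hy)).comp y ((h.hasDerivAt_v hy.ne).const_sub c))).congr_deriv ?_
      rw [h.deriv_phi_eq hc hy, Real.sq_sqrt hκ]
      ring
    · have h2 : Tendsto (fun x => c - v x) atBot (𝓝 c) := by
        simpa using h.v_far.const_sub c
      have h3 := (hasDerivAt_potentialOf (√κ) c hc).continuousAt.tendsto.comp h2
      have := h.phi_far.sub h3
      simpa using this
  linarith

/-- In φ' = v' (u - κ/u) both derivatives are positive, hence so is the bracket. -/
lemma sqrt_lt_rel (h : IsPeakedSolitaryWave κ c ρ v φ) (hc : 0 < c) {x : ℝ}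
    (hx : x < 0) : √κ < c - v x := by
  have h1 := h.phi_mono x hx
  rw [h.deriv_phi_eq hc hx] at h1
  have h2 := pos_of_mul_pos_right h1 (h.v_mono x hx).le
  have h3 := h.rel_pos hc hx
  rw [Real.sqrt_lt' h3]
  rw [sub_pos, div_lt_iff₀ h3] at h2
  nlinarith

/-- The Poisson equation multiplied by φ' is an exact derivative. -/
lemma hasDerivAt_energy (h : IsPeakedSolitaryWave κ c ρ v φ) (hκ : 0 ≤ κ) (hc : 0 < c) {x : ℝ}
    (hx : x < 0) :
    HasDerivAt (fun x => (deriv φ x) ^ 2 / 2 - energyOf (√κ) c (c - v x)) 0 x := by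
  have hu := h.rel_pos hc hx
  refine ((((h.hasDerivAt_deriv_phi hx.ne).pow 2).div_const 2).sub ((hasDerivAt_energyOf (√κ) c
    hu).comp x ((h.hasDerivAt_v hx.ne).const_sub c))).congr_deriv ?_
  rw [h.deriv_phi_eq hc hx, Real.sq_sqrt hκ, h.rho_eq hc hx, chargeOf, h.phi_eq hκ hc hx]
  simp only [Nat.cast_ofNat, Nat.add_one_sub_one, pow_one]
  field_simp
  ring

/-- Let E be the conserved energy difference. As φ' > 0, it tends to √(2E) at -∞; since φ itself
converges, this limit is zero, so E = 0. -/
lemma deriv_phi_sq (h : IsPeakedSolitaryWave κ c ρ v φ) (hκ : 0 ≤ κ) (hc : 0 < c) {x : ℝ}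
    (hx : x < 0) : (deriv φ x) ^ 2 = 2 * energyOf (√κ) c (c - v x) ∧
      Tendsto (deriv φ) atBot (𝓝 0) := by
  obtain ⟨E, hE⟩ : ∃ E, ∀ y < 0, (deriv φ y) ^ 2 / 2 - energyOf (√κ) c (c - v y) = E :=
    ⟨_, fun y hy => isOpen_Iio.is_const_of_deriv_eq_zero isPreconnected_Iio
      (fun z hz => (h.hasDerivAt_energy hκ hc hz).differentiableAt.differentiableWithinAt)
      (fun z hz => (h.hasDerivAt_energy hκ hc hz).deriv) hy hx⟩
  have h1 : Tendsto (fun y => 2 * (E + energyOf (√κ) c (c - v y))) atBot (𝓝 (2 * E)) := by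
    have h2 : Tendsto (fun x => c - v x) atBot (𝓝 c) := by
      simpa using h.v_far.const_sub c
    have h3 := (hasDerivAt_energyOf (√κ) c hc).continuousAt.tendsto.comp h2
    rw [energyOf_self _ hc] at h3
    simpa using (h3.const_add E).const_mul 2
  have h4 : Tendsto (fun y => (deriv φ y) ^ 2) atBot (𝓝 (2 * E)) := by
    refine h1.congr' ?_
    filter_upwards [Iio_mem_atBot (0 : ℝ)] with y hy
    rw [← hE y hy]
    ring
  have hE0 : 0 ≤ 2 * E := ge_of_tendsto' h4 fun y => sq_nonneg _
  have h5 : Tendsto (deriv φ) atBot (𝓝 √(2 * E)) := by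
    refine ((Real.continuous_sqrt.tendsto _).comp h4).congr' ?_
    filter_upwards [Iio_mem_atBot (0 : ℝ)] with y hy
    exact Real.sqrt_sq (h.phi_mono y hy).le
  have h6 := limit_deriv_eq_zero_of_tendsto_atBot (fun y hy => h.hasDerivAt_phi hy.ne)
    h.phi_far h5
  rw [h6] at h5
  refine ⟨?_, h5⟩
  have h7 : E = 0 := by
    have := (Real.sqrt_eq_zero hE0).1 h6
    linarith
  have := hE x hx
  rw [h7] at this
  linarith

lemma deriv_phi_eq_sqrt (h : IsPeakedSolitaryWave κ c ρ v φ) (hκ : 0 ≤ κ) (hc : 0 < c) {x : ℝ}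
    (hx : x < 0) : deriv φ x = √(2 * energyOf (√κ) c (c - v x)) := by
  rw [← (h.deriv_phi_sq hκ hc hx).1, Real.sqrt_sq (h.phi_mono x hx).le]

lemma deriv_v_eq_mul (h : IsPeakedSolitaryWave κ c ρ v φ) (hκ : 0 ≤ κ) (hc : 0 < c) {x : ℝ}
    (hx : x < 0) : deriv v x = (c - v x) * deriv φ x / ((c - v x) ^ 2 - √κ ^ 2) := by
  have h1 := h.rel_pos hc hx
  have h2 := h.sqrt_lt_rel hc hx
  have h3 : 0 < (c - v x) ^ 2 - √κ ^ 2 := by nlinarith [Real.sqrt_nonneg κ]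
  rw [eq_div_iff h3.ne', h.deriv_phi_eq hc hx, Real.sq_sqrt hκ]
  field_simp

lemma continuous_v (h : IsPeakedSolitaryWave κ c ρ v φ) : Continuous v := by
  refine continuous_iff_continuousAt.2 fun x => ?_
  rcases eq_or_ne x 0 with rfl | hx
  · exact h.v_continuous
  · exact (h.hasDerivAt_v hx).continuousAt

lemma deriv_phi_neg (h : IsPeakedSolitaryWave κ c ρ v φ) (x : ℝ) :
    deriv φ (-x) = -deriv φ x := by
  have h1 := deriv_comp_neg φ x
  have h2 : (fun x => φ (-x)) = φ := funext h.phi_even'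
  rw [h2] at h1
  linarith

lemma deriv_phi_zero (h : IsPeakedSolitaryWave κ c ρ v φ) : deriv φ 0 = 0 := by
  have := h.deriv_phi_neg 0
  rw [neg_zero] at this
  linarith

/-- The wave is sonic at its peak. -/
lemma v_zero (h : IsPeakedSolitaryWave κ c ρ v φ) (hκ : 0 ≤ κ) (hc : 0 < c) : v 0 = c - √κ := by
  have hv : Tendsto (fun x => c - v x) (𝓝 0) (𝓝 (c - v 0)) := h.v_continuous.const_sub c
  have hv' : Tendsto (fun x => c - v x) (𝓝[<] 0) (𝓝 (c - v 0)) := hv.mono_left nhdsWithin_le_nhds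
  have hle : √κ ≤ c - v 0 := by
    refine ge_of_tendsto hv' ?_
    filter_upwards [self_mem_nhdsWithin] with x hx using (h.sqrt_lt_rel hc hx).le
  rcases hle.eq_or_lt with heq | hlt
  · linarith
  -- If the peak were supersonic, all fields would be regular up to it. The one-sided limit of φ'
  -- would be the derivative of φ at 0, which is zero by evenness. Then v' tends to zero as well, so
  -- v is differentiable at 0 and there is no peak.
  exfalso
  have hu0 : 0 < c - v 0 := (Real.sqrt_nonneg κ).trans_lt hlt
  have h1 : Tendsto (deriv φ) (𝓝[<] 0) (𝓝 √(2 * energyOf (√κ) c (c - v 0))) := by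
    have h2 := ((hasDerivAt_energyOf (√κ) c hu0).continuousAt.tendsto.comp hv').const_mul 2
    refine ((Real.continuous_sqrt.tendsto _).comp h2).congr' ?_
    filter_upwards [self_mem_nhdsWithin] with x hx
    exact (h.deriv_phi_eq_sqrt hκ hc hx).symm
  have h2 : √(2 * energyOf (√κ) c (c - v 0)) = 0 := by
    have h3 : HasDerivWithinAt φ (√(2 * energyOf (√κ) c (c - v 0))) (Set.Iic 0) 0 :=
      hasDerivWithinAt_Iic_of_tendsto_deriv (s := Set.Iio 0)
        (fun x hx => (h.hasDerivAt_phi (ne_of_lt hx)).differentiableAt.differentiableWithinAt)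
        h.phi_differentiable.continuousAt.continuousWithinAt self_mem_nhdsWithin h1
    have h4 : HasDerivWithinAt φ (deriv φ 0) (Set.Iic 0) 0 :=
      h.phi_differentiable.hasDerivAt.hasDerivWithinAt
    rw [(uniqueDiffWithinAt_Iic 0).eq_deriv _ h3 h4, h.deriv_phi_zero]
  rw [h2] at h1
  have h3 : Tendsto (deriv v) (𝓝[<] 0) (𝓝 0) := by
    have h4 : (c - v 0) ^ 2 - √κ ^ 2 ≠ 0 := by
      have : 0 < (c - v 0) ^ 2 - √κ ^ 2 := by nlinarith [Real.sqrt_nonneg κ]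
      exact this.ne'
    have h5 := (hv'.mul h1).div ((hv'.pow 2).sub_const (√κ ^ 2)) h4
    simp only [mul_zero, zero_div] at h5
    refine h5.congr' ?_
    filter_upwards [self_mem_nhdsWithin] with x hx
    exact (h.deriv_v_eq_mul hκ hc hx).symm
  have hl : HasDerivWithinAt v 0 (Set.Iic 0) 0 :=
    hasDerivWithinAt_Iic_of_tendsto_deriv (s := Set.Iio 0)
      (fun x hx => (h.hasDerivAt_v (ne_of_lt hx)).differentiableAt.differentiableWithinAt)
      h.v_continuous.continuousWithinAt self_mem_nhdsWithin h3
  have hr : HasDerivWithinAt v 0 (Set.Ici 0) 0 := by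
    have h4 : HasDerivWithinAt v 0 (Set.Iic 0) (-0) := by rwa [neg_zero]
    have h5 := HasDerivWithinAt.comp (0 : ℝ) h4 (hasDerivAt_neg (0 : ℝ)).hasDerivWithinAt
      (s := Set.Ici 0) (fun x hx => by simpa using hx)
    rw [zero_mul] at h5
    exact h5.congr_of_mem (fun x _ => (h.v_even' x).symm) Set.self_mem_Ici
  have hd : HasDerivAt v 0 0 := by
    have := hl.union hr
    rwa [Set.Iic_union_Ici, hasDerivWithinAt_univ] at this
  rcases h.peak with hpk | hpk
  -- A corner of ρ alone is impossible too: `rho_value` extends ρ = c/(c - v) to the point 0, so ρ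
  -- inherits differentiability from v.
  · have hρ : ∀ x, x ≠ 0 → ρ x = c / (c - v x) := fun x hx => by
      rcases lt_or_gt_of_ne hx with hx | hx
      · exact h.rho_eq hc hx
      · rw [h.rho_even x hx.ne', h.rho_eq hc (neg_lt_zero.2 hx), h.v_even']
    have hρ0 : ρ 0 = c / (c - v 0) := by
      refine h.rho_value _ ?_
      refine ((tendsto_const_nhds.div hv hu0.ne').mono_left nhdsWithin_le_nhds).congr' ?_
      filter_upwards [self_mem_nhdsWithin] with x hx using (hρ x hx).symm
    have hρ' : ρ = fun x => c / (c - v x) := by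
      funext x
      rcases eq_or_ne x 0 with rfl | hx
      · exact hρ0
      · exact hρ x hx
    have hd' := (hasDerivAt_const (0 : ℝ) c).div (hd.const_sub c) hu0.ne'
    rw [hρ'] at hpk
    exact not_distinctOneSidedDerivs hd' hpk
  · exact not_distinctOneSidedDerivs hd hpk

/-- φ' tends to zero from the left because the energy vanishes at the sonic point, and from the
right because φ' is odd. The limit is taken within u ≥ s, where continuity of the energy is
available also for s = 0. -/
lemma contDiff_phi (h : IsPeakedSolitaryWave κ c ρ v φ) (hκ : 0 ≤ κ)
    (hc : CriticalPair (√κ) c) : ContDiff ℝ 1 φ := by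
  rw [contDiff_one_iff_deriv]
  have hleft : Tendsto (deriv φ) (𝓝[<] 0) (𝓝 0) := by
    have hv : Tendsto (fun x => c - v x) (𝓝[<] 0) (𝓝[≥] √κ) := by
      refine tendsto_nhdsWithin_iff.2 ⟨?_, ?_⟩
      · have := h.v_continuous.const_sub c
        rw [h.v_zero hκ hc.pos, sub_sub_cancel] at this
        exact this.mono_left nhdsWithin_le_nhds
      · filter_upwards [self_mem_nhdsWithin] with x hx using (h.sqrt_lt_rel hc.pos hx).le
    have h1 : Tendsto (energyOf (√κ) c) (𝓝[≥] √κ) (𝓝 0) := by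
      have := continuousOn_energyOf c hc.nonneg (√κ) Set.self_mem_Ici
      rwa [ContinuousWithinAt, hc.energyOf_eq_zero] at this
    have h2 := ((Real.continuous_sqrt.tendsto _).comp ((h1.comp hv).const_mul 2))
    rw [mul_zero, Real.sqrt_zero] at h2
    refine h2.congr' ?_
    filter_upwards [self_mem_nhdsWithin] with x hx
    exact (h.deriv_phi_eq_sqrt hκ hc.pos hx).symm
  have hright : Tendsto (deriv φ) (𝓝[>] 0) (𝓝 0) := by
    have h1 : Tendsto (fun x : ℝ => -x) (𝓝[>] 0) (𝓝[<] 0) := by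
      have := tendsto_neg_nhdsGT (a := (0 : ℝ))
      rwa [neg_zero] at this
    have h2 := (hleft.comp h1).neg
    rw [neg_zero] at h2
    refine h2.congr fun x => ?_
    simp [h.deriv_phi_neg]
  refine ⟨fun x => ?_, continuous_iff_continuousAt.2 fun x => ?_⟩
  · rcases eq_or_ne x 0 with rfl | hx
    · exact h.phi_differentiable
    · exact (h.hasDerivAt_phi hx).differentiableAt
  · rcases eq_or_ne x 0 with rfl | hx
    · rw [continuousAt_iff_continuous_left'_right', ContinuousWithinAt, ContinuousWithinAt,
        h.deriv_phi_zero]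
      exact ⟨hleft, hright⟩
    · exact (h.hasDerivAt_deriv_phi hx).continuousAt

lemma reducedWave (h : IsPeakedSolitaryWave κ c ρ v φ) (hκ : 0 ≤ κ)
    (hc : CriticalPair (√κ) c) : ReducedWave (√κ) c ρ v φ where
  pair := hc
  lt_rel x hx := h.sqrt_lt_rel hc.pos hx
  rel_lt x hx := by have := h.v_pos hx; linarith
  rho_eq x hx := h.rho_eq hc.pos hx
  phi_eq x hx := h.phi_eq hκ hc.pos hx
  energy_pos x hx := by
    have h1 := (h.deriv_phi_sq hκ hc.pos hx).1
    have h2 := pow_pos (h.phi_mono x hx) 2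
    linarith
  phi_deriv x hx := by
    rw [← h.deriv_phi_eq_sqrt hκ hc.pos hx]
    exact h.hasDerivAt_phi hx.ne
  v_deriv x hx := by
    rw [slopeOf, ← h.deriv_phi_eq_sqrt hκ hc.pos hx, ← h.deriv_v_eq_mul hκ hc.pos hx]
    exact h.hasDerivAt_v hx.ne
  v_zero := h.v_zero hκ hc.pos
  v_far := h.v_far
  phi_far := h.phi_far
  phi_deriv_far := (h.deriv_phi_sq hκ hc.pos (neg_one_lt_zero)).2
  v_cont := h.continuous_v
  phi_cont_diff := h.contDiff_phi hκ hc
  phi_deriv_zero := h.deriv_phi_zero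
  phi_deriv2 x hx := h.hasDerivAt_deriv_phi hx
  rho_cont := h.rho_smooth.continuousOn
  rho_even x hx := (h.rho_even x hx).symm
  v_even := h.v_even'
  phi_even := h.phi_even'

end IsPeakedSolitaryWave

end

/-! ### Uniform bounds: decay at infinity and singularity at the peak -/

/-- A function with an algebraic singularity at zero and exponential decay at infinity. -/
noncomputable def decayFn (a μ x : ℝ) : ℝ := (1 + |x| ^ (-a)) * Real.exp (-μ * |x|)

lemma exp_le_decayFn (a μ x : ℝ) : Real.exp (-μ * |x|) ≤ decayFn a μ x := by
  rw [decayFn]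
  have : 0 ≤ |x| ^ (-a) := by positivity
  have h2 := Real.exp_pos (-μ * |x|)
  nlinarith

namespace ReducedWave

variable {s c k K A : ℝ} {ρ v φ : ℝ → ℝ}

lemma v_pos (h : ReducedWave s c ρ v φ) {x : ℝ} (hx : x < 0) : 0 < v x := by
  have := h.rel_lt x hx
  linarith

lemma rel_pos (h : ReducedWave s c ρ v φ) {x : ℝ} (hx : x < 0) : 0 < c - v x :=
  h.pair.nonneg.trans_lt (h.lt_rel x hx)

lemma slope_pos (h : ReducedWave s c ρ v φ) {x : ℝ} (hx : x < 0) :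
    0 < slopeOf s c (c - v x) := by
  have h1 := h.rel_pos hx
  have h2 := h.lt_rel x hx
  have h3 := h.energy_pos x hx
  have h4 := h.pair.nonneg
  have h5 : 0 < (c - v x) ^ 2 - s ^ 2 := by nlinarith
  rw [slopeOf]
  positivity

lemma monotoneOn_v (h : ReducedWave s c ρ v φ) : MonotoneOn v (Set.Iic 0) := by
  refine monotoneOn_of_deriv_nonneg (convex_Iic 0) h.v_cont.continuousOn
    (fun x hx => ?_) fun x hx => ?_ <;> rw [interior_Iic] at hx
  · exact (h.v_deriv x hx).differentiableAt.differentiableWithinAt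
  · rw [(h.v_deriv x hx).deriv]
    exact (h.slope_pos hx).le

/-- Since √u ≤ √A, the slope bound gives v' ≥ μ v with μ = k/√A, so v exp(-μ x) increases up to its
value c - s ≤ A at the peak. -/
lemma v_le (h : ReducedWave s c ρ v φ) (hb : SlopeBounds k K s c) (hk : 0 < k) (hA : c ≤ A)
    {x : ℝ} (hx : x < 0) : v x ≤ A * Real.exp (k / √A * x) := by
  set μ := k / √A with hμ
  have hA0 : 0 < A := h.pair.pos.trans_le hA
  have hmono : MonotoneOn (fun x => v x * Real.exp (-μ * x)) (Set.Iic 0) := by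
    have hd : ∀ x < 0, HasDerivAt (fun x => v x * Real.exp (-μ * x))
        ((slopeOf s c (c - v x) - μ * v x) * Real.exp (-μ * x)) x := fun x hx => by
      refine ((h.v_deriv x hx).mul ((hasDerivAt_id x).const_mul (-μ)).exp).congr_deriv ?_
      simp only [id]
      ring
    refine monotoneOn_of_deriv_nonneg (convex_Iic 0)
      (h.v_cont.mul (by fun_prop)).continuousOn
      (fun x hx => ?_) fun x hx => ?_ <;> rw [interior_Iic] at hx
    · exact (hd x hx).differentiableAt.differentiableWithinAt
    · rw [(hd x hx).deriv]
      refine mul_nonneg ?_ (Real.exp_pos _).le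
      have h1 := (hb _ (h.lt_rel x hx) (h.rel_lt x hx)).1
      rw [sub_sub_cancel] at h1
      have h2 : μ * v x ≤ k * (v x / √(c - v x)) := by
        rw [hμ, div_mul_eq_mul_div, mul_div_assoc]
        have := h.v_pos hx
        have := Real.sqrt_pos.2 (h.rel_pos hx)
        have := (h.rel_lt x hx).le.trans hA
        gcongr
      linarith
  have h1 := hmono (Set.mem_Iic.2 hx.le) Set.self_mem_Iic hx.le
  simp only [mul_zero, Real.exp_zero, mul_one, h.v_zero] at h1
  have h2 : v x * Real.exp (-μ * x) ≤ A := by linarith [h.pair.nonneg]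
  calc v x = v x * Real.exp (-μ * x) * Real.exp (μ * x) := by
        rw [mul_assoc, ← Real.exp_add]; simp
    _ ≤ _ := by gcongr

/-- The power 3/2 is chosen so that √u cancels the singularity of the slope: √u v' is comparable to
v. -/
lemma hasDerivAt_rel_rpow (h : ReducedWave s c ρ v φ) {x : ℝ} (hx : x < 0) :
    HasDerivAt (fun x => (c - v x) ^ (3 / 2 : ℝ))
      (-(3 / 2 * (√(c - v x) * slopeOf s c (c - v x)))) x := by
  have h1 := ((h.v_deriv x hx).const_sub c).rpow_const (p := 3 / 2) (Or.inl (h.rel_pos hx).ne')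
  refine h1.congr_deriv ?_
  rw [Real.sqrt_eq_rpow]
  norm_num
  ring

lemma continuous_rel_rpow (h : ReducedWave s c ρ v φ) :
    Continuous fun x => (c - v x) ^ (3 / 2 : ℝ) :=
  (continuous_const.sub h.v_cont).rpow_const fun _ => Or.inr (by norm_num)

/-- If u ≤ 1/2 at x, then v ≥ 1/2 on [x, 0], because c > 1 and v is increasing; there u^(3/2) falls
at rate at least 3k/4. Its value s^(3/2) at the peak is dropped, so the bound is free of s. -/
lemma rel_lower (h : ReducedWave s c ρ v φ) (hb : SlopeBounds k K s c) (hk : 0 < k)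
    {x : ℝ} (hx : x < 0) :
    1 / 2 ≤ c - v x ∨ 3 / 4 * k * |x| ≤ (c - v x) ^ (3 / 2 : ℝ) := by
  rcases le_total (1 / 2) (c - v x) with hle | hle
  · exact Or.inl hle
  right
  have hanti : AntitoneOn (fun x => (c - v x) ^ (3 / 2 : ℝ) + 3 / 4 * k * x) (Set.Icc x 0) := by
    have hd : ∀ y < 0, HasDerivAt (fun x => (c - v x) ^ (3 / 2 : ℝ) + 3 / 4 * k * x)
        (-(3 / 2 * (√(c - v y) * slopeOf s c (c - v y))) + 3 / 4 * k) y := fun y hy => by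
      refine ((h.hasDerivAt_rel_rpow hy).add
        ((hasDerivAt_id y).const_mul (3 / 4 * k))).congr_deriv (by ring)
    refine antitoneOn_of_deriv_nonpos (convex_Icc x 0)
      (h.continuous_rel_rpow.add (by fun_prop)).continuousOn
      (fun y hy => ?_) fun y hy => ?_ <;> rw [interior_Icc] at hy
    · exact (hd y hy.2).differentiableAt.differentiableWithinAt
    · rw [(hd y hy.2).deriv]
      have h1 := (hb _ (h.lt_rel y hy.2) (h.rel_lt y hy.2)).1
      rw [sub_sub_cancel] at h1
      have hsq := Real.sqrt_pos.2 (h.rel_pos hy.2)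
      have h2 : k * v y ≤ √(c - v y) * slopeOf s c (c - v y) := by
        calc k * v y = √(c - v y) * (k * (v y / √(c - v y))) := by field_simp
          _ ≤ _ := by gcongr
      have h3 := h.monotoneOn_v (Set.mem_Iic.2 hx.le) (Set.mem_Iic.2 hy.2.le) hy.1.le
      have h4 := h.pair.one_lt
      have h5 : 1 / 2 ≤ v y := by linarith
      nlinarith
  have h1 := hanti ⟨le_rfl, hx.le⟩ ⟨hx.le, le_rfl⟩ hx.le
  simp only [mul_zero, add_zero, h.v_zero, sub_sub_cancel] at h1
  have h2 : 0 ≤ s ^ (3 / 2 : ℝ) := Real.rpow_nonneg h.pair.nonneg _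
  rw [abs_of_neg hx]
  linarith

lemma rel_rpow_le (h : ReducedWave s c ρ v φ) (hb : SlopeBounds k K s c) (hK : 0 < K)
    (hA : c ≤ A) {x : ℝ} (hx : x < 0) :
    (c - v x) ^ (3 / 2 : ℝ) ≤ s ^ (3 / 2 : ℝ) + 3 / 2 * (K * A) * |x| := by
  have hmono : MonotoneOn (fun x => (c - v x) ^ (3 / 2 : ℝ) + 3 / 2 * (K * A) * x)
      (Set.Iic 0) := by
    have hd : ∀ y < 0, HasDerivAt (fun x => (c - v x) ^ (3 / 2 : ℝ) + 3 / 2 * (K * A) * x)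
        (-(3 / 2 * (√(c - v y) * slopeOf s c (c - v y))) + 3 / 2 * (K * A)) y := fun y hy => by
      refine ((h.hasDerivAt_rel_rpow hy).add
        ((hasDerivAt_id y).const_mul (3 / 2 * (K * A)))).congr_deriv (by ring)
    refine monotoneOn_of_deriv_nonneg (convex_Iic 0)
      (h.continuous_rel_rpow.add (by fun_prop)).continuousOn
      (fun y hy => ?_) fun y hy => ?_ <;> rw [interior_Iic] at hy
    · exact (hd y hy).differentiableAt.differentiableWithinAt
    · rw [(hd y hy).deriv]
      have h1 := (hb _ (h.lt_rel y hy) (h.rel_lt y hy)).2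
      rw [sub_sub_cancel] at h1
      have hsq := Real.sqrt_pos.2 (h.rel_pos hy)
      have h2 : √(c - v y) * slopeOf s c (c - v y) ≤ K * v y := by
        calc √(c - v y) * slopeOf s c (c - v y) ≤ √(c - v y) * (K * (v y / √(c - v y))) := by
              gcongr
          _ = _ := by field_simp
      have h3 : v y ≤ A := by linarith [h.rel_pos hy]
      nlinarith
  have h1 := hmono (Set.mem_Iic.2 hx.le) Set.self_mem_Iic hx.le
  simp only [mul_zero, add_zero, h.v_zero, sub_sub_cancel] at h1
  rw [abs_of_neg hx]
  linarith

/-- At positive temperature the peak is a corner. -/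
lemma rel_sub_le (h : ReducedWave s c ρ v φ) (hb : SlopeBounds k K s c) (hK : 0 < K)
    (hs : 0 < s) {x : ℝ} (hx : x < 0) : c - v x - s ≤ K * (c / √s) * |x| := by
  -- Before the peak u > s, so v' ≤ K c/√s. This Lipschitz constant blows up as s → 0.
  have hmono : MonotoneOn (fun x => K * (c / √s) * x - v x) (Set.Iic 0) := by
    have hd : ∀ y < 0, HasDerivAt (fun x => K * (c / √s) * x - v x)
        (K * (c / √s) - slopeOf s c (c - v y)) y := fun y hy => by
      refine (((hasDerivAt_id y).const_mul (K * (c / √s))).sub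
        (h.v_deriv y hy)).congr_deriv (by ring)
    have hv := h.v_cont
    refine monotoneOn_of_deriv_nonneg (convex_Iic 0) (by fun_prop)
      (fun y hy => ?_) fun y hy => ?_ <;> rw [interior_Iic] at hy
    · exact (hd y hy).differentiableAt.differentiableWithinAt
    · rw [(hd y hy).deriv, sub_nonneg]
      refine ((hb _ (h.lt_rel y hy) (h.rel_lt y hy)).2).trans ?_
      rw [sub_sub_cancel]
      have h1 := h.lt_rel y hy
      have h2 := h.rel_pos hy
      have h3 : v y ≤ c := by linarith
      have := Real.sqrt_pos.2 hs
      have := h.pair.pos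
      gcongr
  have h1 := hmono (Set.mem_Iic.2 hx.le) Set.self_mem_Iic hx.le
  simp only [mul_zero, h.v_zero] at h1
  rw [abs_of_neg hx]
  linarith

lemma sqrt_energy_eq (h : ReducedWave s c ρ v φ) {x : ℝ} (hx : x < 0) :
    √(2 * energyOf s c (c - v x)) =
      slopeOf s c (c - v x) * (((c - v x) ^ 2 - s ^ 2) / (c - v x)) := by
  have h1 := h.rel_pos hx
  have h2 := h.lt_rel x hx
  have h4 := h.pair.nonneg
  have h5 : 0 < (c - v x) ^ 2 - s ^ 2 := by nlinarith
  rw [slopeOf]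
  field_simp

lemma sqrt_energy_le (h : ReducedWave s c ρ v φ) (hb : SlopeBounds k K s c) (hK : 0 < K) {x : ℝ}
    (hx : x < 0) : √(2 * energyOf s c (c - v x)) ≤ K * v x * √(c - v x) := by
  have h1 := h.rel_pos hx
  have h2 := (hb _ (h.lt_rel x hx) (h.rel_lt x hx)).2
  rw [sub_sub_cancel] at h2
  have h3 := h.v_pos hx
  have hsq := Real.sqrt_pos.2 h1
  rw [h.sqrt_energy_eq hx]
  have h4 : ((c - v x) ^ 2 - s ^ 2) / (c - v x) ≤ c - v x := by
    rw [div_le_iff₀ h1]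
    nlinarith [sq_nonneg s]
  calc _ ≤ K * (v x / √(c - v x)) * (c - v x) := by
        refine mul_le_mul h2 h4 (div_nonneg ?_ h1.le) (by positivity)
        nlinarith [h.lt_rel x hx, h.pair.nonneg]
    _ = K * (v x / √(c - v x)) * (√(c - v x) * √(c - v x)) := by rw [Real.mul_self_sqrt h1.le]
    _ = _ := by field_simp

lemma deriv_v_neg (h : ReducedWave s c ρ v φ) (x : ℝ) : deriv v (-x) = -deriv v x := by
  have h1 := deriv_comp_neg v x
  rw [show (fun x => v (-x)) = v from funext h.v_even] at h1
  linarith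

lemma deriv_phi_neg (h : ReducedWave s c ρ v φ) (x : ℝ) : deriv φ (-x) = -deriv φ x := by
  have h1 := deriv_comp_neg φ x
  rw [show (fun x => φ (-x)) = φ from funext h.phi_even] at h1
  linarith

end ReducedWave

lemma inv_le_of_le_rpow {u y a b : ℝ} (hu : 0 < u) (hb : 0 < b) (hab : a * b = 1)
    (hy : 0 < y) (h : y ≤ u ^ b) : u⁻¹ ≤ y ^ (-a) := by
  have ha : 0 < a := by
    by_contra! h
    nlinarith
  rw [Real.rpow_neg hy.le]
  gcongr
  calc y ^ a ≤ (u ^ b) ^ a := by gcongr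
    _ = u := by rw [← Real.rpow_mul hu.le, mul_comm, hab, Real.rpow_one]

lemma two_add_mul_rpow_le {κ y a : ℝ} (hκ : 0 < κ) :
    2 + (κ * |y|) ^ (-a) ≤ (2 + κ ^ (-a)) * (1 + |y| ^ (-a)) := by
  rw [Real.mul_rpow hκ.le (abs_nonneg y)]
  have h1 : 0 ≤ κ ^ (-a) := by positivity
  have h2 : 0 ≤ |y| ^ (-a) := by positivity
  nlinarith

/-- Bounds on all fields of a wave, whose constants only depend on bounds of the slope and the
speed. -/
lemma exists_wave_bounds {k K A : ℝ} (hk : 0 < k) (hK : 0 < K) (hA : 0 < A) :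
    ∃ C μ, 0 < C ∧ 0 < μ ∧ ∀ (s c : ℝ) (ρ v φ : ℝ → ℝ), ReducedWave s c ρ v φ →
      SlopeBounds k K s c → c ≤ A → ∀ x ≠ 0,
        |ρ x - 1| ≤ C * decayFn (2 / 3) μ x ∧ |deriv v x| ≤ C * decayFn (1 / 3) μ x ∧
        |deriv φ x| ≤ C * decayFn 0 μ x ∧ |Real.exp (φ x) - 1| ≤ C * decayFn 0 μ x := by
  set k₁ := 3 / 4 * k with hk₁
  have hk₁0 : 0 < k₁ := by positivity
  set C₁ := A * (2 + k₁ ^ (-(2 / 3) : ℝ))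
  set C₂ := K * A * (2 + k₁ ^ (-(1 / 3) : ℝ))
  set C₃ := K * A * √A
  set C₄ := A * A * Real.exp (A * A)
  set C := C₁ + C₂ + C₃ + C₄ with hC
  have hC₁ : 0 < C₁ := by positivity
  have hC₂ : 0 < C₂ := by positivity
  have hC₃ : 0 < C₃ := by positivity
  have hC₄ : 0 < C₄ := by positivity
  refine ⟨C, k / √A, by positivity, by positivity, fun s c ρ v φ h hb hcA => ?_⟩
  set μ := k / √A
  suffices H : ∀ x < 0, |ρ x - 1| ≤ C * decayFn (2 / 3) μ x ∧
      |deriv v x| ≤ C * decayFn (1 / 3) μ x ∧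
      |deriv φ x| ≤ C * decayFn 0 μ x ∧ |Real.exp (φ x) - 1| ≤ C * decayFn 0 μ x by
    intro x hx
    rcases lt_or_gt_of_ne hx with hx | hx
    · exact H x hx
    · have := H (-x) (neg_lt_zero.2 hx)
      rw [h.rho_even x hx.ne', h.deriv_v_neg, h.deriv_phi_neg, h.phi_even, abs_neg, abs_neg] at this
      simpa only [decayFn, abs_neg] using this
  intro x hx
  have hu0 := h.rel_pos hx
  have huA : c - v x ≤ A := (h.rel_lt x hx).le.trans hcA
  have hv0 := h.v_pos hx
  have hvle : v x ≤ A * Real.exp (-μ * |x|) := by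
    have := h.v_le hb hk hcA hx
    rwa [abs_of_neg hx, neg_mul_neg]
  have hE : 0 < Real.exp (-μ * |x|) := Real.exp_pos _
  have hx0 : 0 < |x| := abs_pos.2 hx.ne
  have hsq := Real.sqrt_pos.2 hu0
  -- The two alternatives of `rel_lower` bound the inverse by one or the other summand.
  have hinv : (c - v x)⁻¹ ≤ 2 + (k₁ * |x|) ^ (-(2 / 3) : ℝ) := by
    rcases h.rel_lower hb hk hx with h1 | h1
    · have h2 : (c - v x)⁻¹ ≤ 2 := by
        rw [inv_le_comm₀ hu0 two_pos]
        linarith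
      have h3 : 0 ≤ (k₁ * |x|) ^ (-(2 / 3) : ℝ) := by positivity
      linarith
    · have := inv_le_of_le_rpow (a := 2 / 3) hu0 (by norm_num) (by norm_num)
        (by positivity) h1
      linarith
  have hinv' : (√(c - v x))⁻¹ ≤ 2 + (k₁ * |x|) ^ (-(1 / 3) : ℝ) := by
    rcases h.rel_lower hb hk hx with h1 | h1
    · have h2 : (√(c - v x))⁻¹ ≤ 2 := by
        rw [inv_le_comm₀ hsq two_pos, Real.le_sqrt' (by norm_num)]
        linarith
      have h3 : 0 ≤ (k₁ * |x|) ^ (-(1 / 3) : ℝ) := by positivity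
      linarith
    · have h2 : (√(c - v x)) ^ (3 : ℝ) = (c - v x) ^ (3 / 2 : ℝ) := by
        rw [Real.sqrt_eq_rpow, ← Real.rpow_mul hu0.le]
        norm_num
      rw [← h2] at h1
      have := inv_le_of_le_rpow (a := 1 / 3) hsq (by norm_num) (by norm_num)
        (by positivity) h1
      linarith
  have hfin : ∀ {C' a y : ℝ}, C' ≤ C → |y| ≤ C' * decayFn a μ x → |y| ≤ C * decayFn a μ x :=
    fun {C' a y} hC' hy => by
      refine hy.trans ?_
      have : 0 ≤ decayFn a μ x := (Real.exp_pos _).le.trans (exp_le_decayFn a μ x)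
      gcongr
  refine ⟨hfin (C' := C₁) (by rw [hC]; linarith) ?_, hfin (C' := C₂) (by rw [hC]; linarith) ?_,
    hfin (C' := C₃) (by rw [hC]; linarith) ?_, hfin (C' := C₄) (by rw [hC]; linarith) ?_⟩
  · have h1 : ρ x - 1 = v x * (c - v x)⁻¹ := by
      rw [h.rho_eq x hx]
      field_simp
      ring
    rw [h1, abs_of_nonneg (by positivity)]
    calc v x * (c - v x)⁻¹
        ≤ A * Real.exp (-μ * |x|) * ((2 + k₁ ^ (-(2 / 3) : ℝ)) * (1 + |x| ^ (-(2 / 3) : ℝ))) := by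
          gcongr
          exact hinv.trans (two_add_mul_rpow_le hk₁0)
      _ = _ := by rw [decayFn]; ring
  · rw [(h.v_deriv x hx).deriv, abs_of_pos (h.slope_pos hx)]
    have h1 := (hb _ (h.lt_rel x hx) (h.rel_lt x hx)).2
    rw [sub_sub_cancel] at h1
    calc slopeOf s c (c - v x) ≤ K * (v x * (√(c - v x))⁻¹) := by rwa [← div_eq_mul_inv]
      _ ≤ K * (A * Real.exp (-μ * |x|) *
          ((2 + k₁ ^ (-(1 / 3) : ℝ)) * (1 + |x| ^ (-(1 / 3) : ℝ)))) := by
          gcongr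
          exact hinv'.trans (two_add_mul_rpow_le hk₁0)
      _ = _ := by rw [decayFn]; ring
  · rw [(h.phi_deriv x hx).deriv, abs_of_nonneg (Real.sqrt_nonneg _)]
    calc _ ≤ K * v x * √(c - v x) := h.sqrt_energy_le hb hK hx
      _ ≤ K * (A * Real.exp (-μ * |x|)) * √A := by gcongr
      _ = C₃ * Real.exp (-μ * |x|) := by ring
      _ ≤ _ := by gcongr; exact exp_le_decayFn _ _ _
  · have h1 : 0 ≤ φ x := by
      rw [h.phi_eq x hx]
      exact potentialOf_nonneg h.pair (h.lt_rel x hx).le (h.rel_lt x hx).le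
    have h2 : φ x ≤ c * v x := by
      have := potentialOf_le h.pair (h.lt_rel x hx) (h.rel_lt x hx).le
      rwa [sub_sub_cancel, ← h.phi_eq x hx] at this
    have hvA : v x ≤ A := by linarith
    have hc0 := h.pair.pos
    have h3 : Real.exp (φ x) - 1 ≤ φ x * Real.exp (φ x) := by
      have h4 := Real.add_one_le_exp (-φ x)
      have h5 : Real.exp (-φ x) * Real.exp (φ x) = 1 := by rw [← Real.exp_add]; simp
      have h6 := mul_le_mul_of_nonneg_right h4 (Real.exp_pos (φ x)).le
      rw [h5] at h6
      linarith
    rw [abs_of_nonneg (by linarith [Real.one_le_exp h1])]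
    calc _ ≤ φ x * Real.exp (φ x) := h3
      _ ≤ (A * (A * Real.exp (-μ * |x|))) * Real.exp (A * A) := by
          have h7 : φ x ≤ A * (A * Real.exp (-μ * |x|)) := h2.trans (by gcongr)
          have h8 : φ x ≤ A * A := h2.trans (by gcongr)
          gcongr
      _ = C₄ * Real.exp (-μ * |x|) := by ring
      _ ≤ _ := by gcongr; exact exp_le_decayFn _ _ _

/-! ### Pointwise convergence by means of the distance to the peak -/

/-- The reciprocal of the slope, extended by zero up to the sonic point. -/
noncomputable def slownessOf (s c u : ℝ) : ℝ := if u ≤ s then 0 else (slopeOf s c u)⁻¹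

/-- The distance to the peak as a function of the relative speed. -/
noncomputable def travelOf (s c u : ℝ) : ℝ := ∫ t in (0 : ℝ)..u, slownessOf s c t

lemma measurable_slownessOf (s c : ℝ) : Measurable (slownessOf s c) := by
  unfold slownessOf slopeOf energyOf potentialOf
  refine Measurable.ite measurableSet_Iic measurable_const ?_
  fun_prop

section
variable {s c k K : ℝ}

lemma slownessOf_pos (hb : SlopeBounds k K s c) (hk : 0 < k) (hs : 0 ≤ s) {u : ℝ} (hu : s < u)
    (huc : u < c) : 0 < slownessOf s c u := by
  rw [slownessOf, if_neg hu.not_ge, inv_pos]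
  have h1 : 0 < √u := Real.sqrt_pos.2 (hs.trans_lt hu)
  have h2 : 0 < c - u := sub_pos.2 huc
  exact lt_of_lt_of_le (by positivity) (hb u hu huc).1

lemma slownessOf_nonneg (hb : SlopeBounds k K s c) (hk : 0 < k) (hs : 0 ≤ s) {u : ℝ}
    (huc : u < c) : 0 ≤ slownessOf s c u := by
  rcases le_or_gt u s with hu | hu
  · rw [slownessOf, if_pos hu]
  · exact (slownessOf_pos hb hk hs hu huc).le

/-- Away from c the slope is bounded below even up to the sonic point. The bound does not involve s
and serves as the dominating function. -/
lemma slownessOf_le (hb : SlopeBounds k K s c) (hk : 0 < k) (hs : 0 ≤ s) {u w A d : ℝ}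
    (huw : u ≤ w) (hd : 0 < d) (hwc : w + d ≤ c) (hwA : w ≤ A) :
    slownessOf s c u ≤ √A / (k * d) := by
  rcases le_or_gt u s with hu | hu
  · rw [slownessOf, if_pos hu]
    positivity
  · rw [slownessOf, if_neg hu.not_ge]
    have h1 : 0 < √u := Real.sqrt_pos.2 (hs.trans_lt hu)
    have h2 : d ≤ c - u := by linarith
    have h3 : √u ≤ √A := Real.sqrt_le_sqrt (huw.trans hwA)
    have h4 : 0 < √A := h1.trans_le h3
    have h5 : 0 ≤ c - u := hd.le.trans h2
    rw [← inv_div]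
    refine inv_anti₀ (by positivity) ?_
    calc k * d / √A ≤ k * ((c - u) / √u) := by
          rw [mul_div_assoc]
          gcongr
      _ ≤ _ := (hb u hu (by linarith)).1

lemma integrableOn_slownessOf (hb : SlopeBounds k K s c) (hk : 0 < k) (hs : 0 ≤ s) {w : ℝ}
    (hw : w < c) : IntegrableOn (slownessOf s c) (Set.Icc 0 w) := by
  refine Measure.integrableOn_of_bounded (M := √w / (k * (c - w))) (by simp)
    (measurable_slownessOf s c).aestronglyMeasurable ?_
  refine (ae_restrict_mem measurableSet_Icc).mono fun x hx => ?_
  rw [Real.norm_of_nonneg (slownessOf_nonneg hb hk hs (hx.2.trans_lt hw))]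
  exact slownessOf_le hb hk hs hx.2 (sub_pos.2 hw) (by linarith) le_rfl

lemma intervalIntegrable_slownessOf (hb : SlopeBounds k K s c) (hk : 0 < k) (hs : 0 ≤ s)
    {a b : ℝ} (ha : 0 ≤ a) (hab : a ≤ b) (hw : b < c) :
    IntervalIntegrable (slownessOf s c) volume a b := by
  rw [intervalIntegrable_iff_integrableOn_Icc_of_le hab]
  exact (integrableOn_slownessOf hb hk hs hw).mono_set (Set.Icc_subset_Icc_left ha)

lemma travelOf_sub (hb : SlopeBounds k K s c) (hk : 0 < k) (hs : 0 ≤ s)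
    {a b : ℝ} (ha : 0 ≤ a) (hab : a ≤ b) (hw : b < c) :
    travelOf s c b - travelOf s c a = ∫ t in a..b, slownessOf s c t :=
  intervalIntegral.integral_interval_sub_left
    (intervalIntegrable_slownessOf hb hk hs le_rfl (ha.trans hab) hw)
    (intervalIntegrable_slownessOf hb hk hs le_rfl ha (hab.trans_lt hw))

lemma travelOf_mono (hb : SlopeBounds k K s c) (hk : 0 < k) (hs : 0 ≤ s)
    {a b : ℝ} (ha : 0 ≤ a) (hab : a ≤ b) (hw : b < c) : travelOf s c a ≤ travelOf s c b := by
  have h1 := travelOf_sub hb hk hs ha hab hw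
  have h2 : 0 ≤ ∫ t in a..b, slownessOf s c t :=
    intervalIntegral.integral_nonneg hab
      fun t ht => slownessOf_nonneg hb hk hs (ht.2.trans_lt hw)
  linarith

lemma travelOf_strictMono (hb : SlopeBounds k K s c) (hk : 0 < k) (hs : 0 ≤ s)
    {a b : ℝ} (ha : s ≤ a) (hab : a < b) (hw : b < c) : travelOf s c a < travelOf s c b := by
  have h1 := travelOf_sub hb hk hs (hs.trans ha) hab.le hw
  have h2 : 0 < ∫ t in a..b, slownessOf s c t :=
    intervalIntegral.intervalIntegral_pos_of_pos_on
      (intervalIntegrable_slownessOf hb hk hs (hs.trans ha) hab.le hw)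
      (fun t ht => slownessOf_pos hb hk hs (ha.trans_lt ht.1) (ht.2.trans hw)) hab
  linarith

lemma hasDerivAt_travelOf (hb : SlopeBounds k K s c) (hk : 0 < k) (hs : 0 ≤ s) {u : ℝ}
    (hu : s < u) (huc : u < c) : HasDerivAt (travelOf s c) (slopeOf s c u)⁻¹ u := by
  have hu0 : 0 < u := hs.trans_lt hu
  have h1 : ContinuousAt (slopeOf s c) u :=
    ContinuousAt.comp (g := fun q : ℝ × ℝ × ℝ => slopeOf q.1 q.2.1 q.2.2)
      (f := fun u : ℝ => (s, c, u)) (continuousAt_slopeOf (hu0.trans huc) hs hu) (by fun_prop)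
  have h2 := slownessOf_pos hb hk hs hu huc
  rw [slownessOf, if_neg hu.not_ge, inv_pos] at h2
  have h3 : ContinuousAt (slownessOf s c) u := by
    refine (h1.inv₀ h2.ne').congr ?_
    filter_upwards [lt_mem_nhds hu] with t ht
    rw [slownessOf, if_neg ht.not_ge, Pi.inv_apply]
  have h4 := intervalIntegral.integral_hasDerivAt_right
    (intervalIntegrable_slownessOf hb hk hs le_rfl hu0.le huc)
    ((measurable_slownessOf s c).stronglyMeasurable.stronglyMeasurableAtFilter) h3
  rwa [slownessOf, if_neg hu.not_ge] at h4

/-- Along the wave `travelOf` has derivative -1, since u' = -v' is minus the slope. The constant is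
found in the limit at the peak, where u tends to s and the integral, continuous up to s, vanishes.
-/
lemma ReducedWave.travelOf_eq {ρ v φ : ℝ → ℝ} (h : ReducedWave s c ρ v φ)
    (hb : SlopeBounds k K s c) (hk : 0 < k) {x : ℝ} (hx : x < 0) :
    travelOf s c (c - v x) = -x := by
  have hs := h.pair.nonneg
  obtain ⟨E, hE⟩ : ∃ E, ∀ y < 0, travelOf s c (c - v y) + y = E := by
    have hd : ∀ y < 0, HasDerivAt (fun y => travelOf s c (c - v y) + y) 0 y := fun y hy => by
      refine (((hasDerivAt_travelOf hb hk hs (h.lt_rel y hy) (h.rel_lt y hy)).comp y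
        ((h.v_deriv y hy).const_sub c)).add (hasDerivAt_id y)).congr_deriv ?_
      rw [mul_neg, inv_mul_cancel₀ (h.slope_pos hy).ne', neg_add_cancel]
    exact ⟨_, fun y hy => isOpen_Iio.is_const_of_deriv_eq_zero isPreconnected_Iio
      (fun z hz => (hd z hz).differentiableAt.differentiableWithinAt)
      (fun z hz => (hd z hz).deriv) hy hx⟩
  obtain ⟨d, hsd, hdc⟩ := exists_between h.pair.lt
  have hcont : ContinuousOn (travelOf s c) (Set.Icc 0 d) := by
    have h1 := intervalIntegral.continuousOn_primitive_interval (a := 0) (b := d)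
      (f := slownessOf s c) (μ := volume)
      (by rw [Set.uIcc_of_le (hs.trans hsd.le)]; exact integrableOn_slownessOf hb hk hs hdc)
    rwa [Set.uIcc_of_le (hs.trans hsd.le)] at h1
  have hzero : travelOf s c s = 0 := by
    rw [travelOf]
    refine intervalIntegral.integral_zero_ae (Eventually.of_forall fun t ht => ?_)
    rw [Set.uIoc_of_le hs] at ht
    rw [slownessOf, if_pos ht.2]
  have hlim : Tendsto (fun y => c - v y) (𝓝[<] 0) (𝓝[Set.Icc 0 d] s) := by
    have h1 : Tendsto (fun y => c - v y) (𝓝[<] 0) (𝓝 s) := by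
      have h2 := (h.v_cont.tendsto 0).const_sub c
      rw [h.v_zero, sub_sub_cancel] at h2
      exact h2.mono_left nhdsWithin_le_nhds
    refine tendsto_nhdsWithin_iff.2 ⟨h1, ?_⟩
    filter_upwards [self_mem_nhdsWithin, h1.eventually_lt_const hsd] with y hy hyd
    exact ⟨(h.rel_pos hy).le, hyd.le⟩
  have h1 : Tendsto (fun y => travelOf s c (c - v y) + y) (𝓝[<] 0) (𝓝 (0 + 0)) := by
    have h2 := (hcont s ⟨hs, hsd.le⟩).tendsto.comp hlim
    rw [hzero] at h2
    exact h2.add (tendsto_id.mono_left nhdsWithin_le_nhds)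
  have h2 : Tendsto (fun y => travelOf s c (c - v y) + y) (𝓝[<] 0) (𝓝 E) :=
    tendsto_const_nhds.congr' (by
      filter_upwards [self_mem_nhdsWithin] with y hy using (hE y hy).symm)
  have h3 := tendsto_nhds_unique h1 h2
  have h4 := hE x hx
  linarith

end

section
variable {ι : Type*} {l : Filter ι} [l.IsCountablyGenerated] {s c : ι → ℝ} {c₀ k K : ℝ}

/-- Extending by zero below s lets all integrals run over the same interval. At each t > 0
eventually s i < t, so the integrands converge, and they are bounded by a constant. -/
lemma tendsto_travelOf (h₀ : CriticalPair 0 c₀) (hb₀ : SlopeBounds k K 0 c₀) (hk : 0 < k)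
    (hb : ∀ᶠ i in l, CriticalPair (s i) (c i) ∧ SlopeBounds k K (s i) (c i))
    (hs : Tendsto s l (𝓝 0)) (hc : Tendsto c l (𝓝 c₀)) {u : ℝ} (hu : 0 < u) (huc : u < c₀) :
    Tendsto (fun i => travelOf (s i) (c i) u) l (𝓝 (travelOf 0 c₀ u)) := by
  set d := (c₀ - u) / 2 with hd
  have hd0 : 0 < d := by rw [hd]; linarith
  refine intervalIntegral.tendsto_integral_filter_of_dominated_convergence
    (fun _ => √u / (k * d)) ?_ ?_ (by simp) ?_
  · exact Eventually.of_forall fun i => (measurable_slownessOf _ _).aestronglyMeasurable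
  · filter_upwards [hb, hc.eventually_const_lt (u := u + d) (by rw [hd]; linarith)] with i hi hci
    refine Eventually.of_forall fun t ht => ?_
    rw [Set.uIoc_of_le hu.le] at ht
    rw [Real.norm_of_nonneg (slownessOf_nonneg hi.2 hk hi.1.nonneg (by linarith [ht.2]))]
    exact slownessOf_le hi.2 hk hi.1.nonneg ht.2 hd0 hci.le le_rfl
  · refine Eventually.of_forall fun t ht => ?_
    rw [Set.uIoc_of_le hu.le] at ht
    have h1 : Tendsto (fun i => slopeOf (s i) (c i) t) l (𝓝 (slopeOf 0 c₀ t)) :=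
      (continuousAt_slopeOf h₀.pos le_rfl ht.1).tendsto.comp
        (hs.prodMk_nhds (hc.prodMk_nhds tendsto_const_nhds))
    have h2 := slownessOf_pos hb₀ hk le_rfl ht.1 (ht.2.trans_lt huc)
    rw [slownessOf, if_neg ht.1.not_ge, inv_pos] at h2
    rw [slownessOf, if_neg ht.1.not_ge]
    refine (h1.inv₀ h2.ne').congr' ?_
    filter_upwards [hs.eventually_lt_const ht.1] with i hi
    rw [slownessOf, if_neg hi.not_ge]

variable {ρ v φ : ι → ℝ → ℝ} {ρ₀ v₀ φ₀ : ℝ → ℝ}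

/-- Convergence of inverse functions: `travelOf` takes the value -x at the relative speed of every
wave. If w is below the limiting speed, the limiting travel function at w is strictly less than -x;
so eventually is that of wave i, whose monotonicity puts its speed above w. The upper bound is
symmetric. -/
lemma tendsto_rel (h₀ : ReducedWave 0 c₀ ρ₀ v₀ φ₀) (hb₀ : SlopeBounds k K 0 c₀) (hk : 0 < k)
    (h : ∀ᶠ i in l, ReducedWave (s i) (c i) (ρ i) (v i) (φ i) ∧ SlopeBounds k K (s i) (c i))
    (hs : Tendsto s l (𝓝 0)) (hc : Tendsto c l (𝓝 c₀)) {x : ℝ} (hx : x < 0) :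
    Tendsto (fun i => c i - v i x) l (𝓝 (c₀ - v₀ x)) := by
  have hb : ∀ᶠ i in l, CriticalPair (s i) (c i) ∧ SlopeBounds k K (s i) (c i) :=
    h.mono fun i hi => ⟨hi.1.pair, hi.2⟩
  have ht₀ := h₀.travelOf_eq hb₀ hk hx
  have hu₀ := h₀.rel_pos hx
  have huc := h₀.rel_lt x hx
  rw [tendsto_order]
  constructor
  · intro a ha
    obtain ⟨w, hw1, hw2⟩ := exists_between (max_lt ha hu₀)
    have hw0 : 0 < w := (le_max_right _ _).trans_lt hw1
    have h1 := travelOf_strictMono hb₀ hk le_rfl hw0.le hw2 huc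
    rw [ht₀] at h1
    filter_upwards [h, (tendsto_travelOf h₀.pair hb₀ hk hb hs hc hw0
      (hw2.trans huc)).eventually_lt_const h1, hc.eventually_const_lt (hw2.trans huc)]
      with i hi h2 h3
    refine ((le_max_left _ _).trans_lt hw1).trans ?_
    by_contra! hle
    have := travelOf_mono hi.2 hk hi.1.pair.nonneg (hi.1.rel_pos hx).le hle h3
    rw [hi.1.travelOf_eq hi.2 hk hx] at this
    linarith
  · intro b hb'
    obtain ⟨w, hw1, hw2⟩ := exists_between (lt_min hb' huc)
    have hw0 : 0 < w := hu₀.trans hw1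
    have hwc : w < c₀ := hw2.trans_le (min_le_right _ _)
    have h1 := travelOf_strictMono hb₀ hk le_rfl hu₀.le hw1 hwc
    rw [ht₀] at h1
    filter_upwards [h, (tendsto_travelOf h₀.pair hb₀ hk hb hs hc hw0
      hwc).eventually_const_lt h1] with i hi h2
    refine lt_trans ?_ (hw2.trans_le (min_le_left _ _))
    by_contra! hle
    have := travelOf_mono hi.2 hk hi.1.pair.nonneg hw0.le hle (hi.1.rel_lt x hx)
    rw [hi.1.travelOf_eq hi.2 hk hx] at this
    linarith

/-- Pointwise convergence of all fields away from the peak. -/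
lemma tendsto_fields (h₀ : ReducedWave 0 c₀ ρ₀ v₀ φ₀) (hb₀ : SlopeBounds k K 0 c₀) (hk : 0 < k)
    (h : ∀ᶠ i in l, ReducedWave (s i) (c i) (ρ i) (v i) (φ i) ∧ SlopeBounds k K (s i) (c i))
    (hs : Tendsto s l (𝓝 0)) (hc : Tendsto c l (𝓝 c₀)) {x : ℝ} (hx : x ≠ 0) :
    Tendsto (fun i => ρ i x) l (𝓝 (ρ₀ x)) ∧
    Tendsto (fun i => deriv (v i) x) l (𝓝 (deriv v₀ x)) ∧
    Tendsto (fun i => deriv (φ i) x) l (𝓝 (deriv φ₀ x)) ∧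
    Tendsto (fun i => φ i x) l (𝓝 (φ₀ x)) := by
  suffices H : ∀ x < 0, Tendsto (fun i => ρ i x) l (𝓝 (ρ₀ x)) ∧
      Tendsto (fun i => deriv (v i) x) l (𝓝 (deriv v₀ x)) ∧
      Tendsto (fun i => deriv (φ i) x) l (𝓝 (deriv φ₀ x)) ∧
      Tendsto (fun i => φ i x) l (𝓝 (φ₀ x)) by
    rcases lt_or_gt_of_ne hx with hx | hx
    · exact H x hx
    · obtain ⟨h1, h2, h3, h4⟩ := H (-x) (neg_lt_zero.2 hx)
      rw [h₀.rho_even x hx.ne'] at h1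
      rw [h₀.deriv_v_neg] at h2
      rw [h₀.deriv_phi_neg] at h3
      rw [h₀.phi_even] at h4
      have h2' := h2.neg
      have h3' := h3.neg
      rw [neg_neg] at h2' h3'
      refine ⟨h1.congr' ?_, h2'.congr' ?_, h3'.congr' ?_, h4.congr' ?_⟩ <;>
        filter_upwards [h] with i hi
      · exact hi.1.rho_even x hx.ne'
      · rw [hi.1.deriv_v_neg, neg_neg]
      · rw [hi.1.deriv_phi_neg, neg_neg]
      · exact hi.1.phi_even x
  intro x hx
  have hu := tendsto_rel h₀ hb₀ hk h hs hc hx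
  have hu₀ := h₀.rel_pos hx
  have hq : Tendsto (fun i => (s i, c i, c i - v i x)) l (𝓝 (0, c₀, c₀ - v₀ x)) :=
    hs.prodMk_nhds (hc.prodMk_nhds hu)
  refine ⟨?_, ?_, ?_, ?_⟩
  · rw [h₀.rho_eq x hx]
    refine (hc.div hu hu₀.ne').congr' ?_
    filter_upwards [h] with i hi using (hi.1.rho_eq x hx).symm
  · rw [(h₀.v_deriv x hx).deriv]
    refine ((continuousAt_slopeOf h₀.pair.pos le_rfl hu₀).tendsto.comp hq).congr' ?_
    filter_upwards [h] with i hi using (hi.1.v_deriv x hx).deriv.symm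
  · rw [(h₀.phi_deriv x hx).deriv]
    refine ((Real.continuous_sqrt.tendsto _).comp
      (((continuousAt_energyOf h₀.pair.pos hu₀).tendsto.comp hq).const_mul 2)).congr' ?_
    filter_upwards [h] with i hi using (hi.1.phi_deriv x hx).deriv.symm
  · rw [h₀.phi_eq x hx]
    refine ((continuousAt_potentialOf h₀.pair.pos hu₀).tendsto.comp hq).congr' ?_
    filter_upwards [h] with i hi using (hi.1.phi_eq x hx).symm

end

/-! ### Dominated convergence, Morrey's inequality and power singularities -/

/-- Dominated convergence in `L^p`. -/
lemma tendsto_eLpNorm_of_dominated {α ι : Type*} {m : MeasurableSpace α} {μ : Measure α}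
    {l : Filter ι} [l.IsCountablyGenerated] {F : ι → α → ℝ} {g : α → ℝ} {p : ℝ≥0∞}
    (hp0 : p ≠ 0) (hp : p ≠ ∞) (hg : MemLp g p μ)
    (hF : ∀ᶠ i in l, AEStronglyMeasurable (F i) μ) (hle : ∀ᶠ i in l, ∀ᵐ x ∂μ, |F i x| ≤ g x)
    (hlim : ∀ᵐ x ∂μ, Tendsto (fun i => F i x) l (𝓝 0)) :
    Tendsto (fun i => eLpNorm (F i) p μ) l (𝓝 0) := by
  have hp' : 0 < p.toReal := ENNReal.toReal_pos hp0 hp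
  have h1 : Tendsto (fun i => ∫⁻ x, ‖F i x‖ₑ ^ p.toReal ∂μ) l (𝓝 (∫⁻ _, 0 ∂μ)) := by
    refine tendsto_lintegral_filter_of_dominated_convergence' (fun x => ‖g x‖ₑ ^ p.toReal)
      (hF.mono fun i hi => hi.enorm.pow_const _) (hle.mono fun i hi => hi.mono fun x hx => ?_)
      ?_ (hlim.mono fun x hx => ?_)
    · have : ‖F i x‖ₑ ≤ ‖g x‖ₑ := enorm_le_iff_norm_le.2 (hx.trans (le_abs_self _))
      gcongr
    · have h2 := lintegral_rpow_enorm_lt_top_of_eLpNorm_lt_top hp0 hp hg.2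
      exact h2.ne
    · have h2 := ((ENNReal.continuous_rpow_const (y := p.toReal)).tendsto _).comp hx.enorm
      simpa [hp', Function.comp_def] using h2
  rw [lintegral_zero] at h1
  have h2 := ((ENNReal.continuous_rpow_const (y := 1 / p.toReal)).tendsto _).comp h1
  rw [ENNReal.zero_rpow_of_pos (by positivity)] at h2
  refine h2.congr fun i => ?_
  rw [eLpNorm_eq_lintegral_rpow_enorm_toReal hp0 hp]
  rfl

lemma integrable_comp_abs_of_integrableOn_Ioi {f : ℝ → ℝ} (hf : IntegrableOn f (Set.Ioi 0)) :
    Integrable fun x => f |x| := by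
  have h1 : IntegrableOn (fun x => f |x|) (Set.Ioi 0) :=
    hf.congr_fun (fun x hx => by rw [abs_of_pos hx]) measurableSet_Ioi
  have h2 : IntegrableOn (fun x => f |x|) (Set.Iic 0) := by
    rw [← Measure.map_neg_eq_self (volume : Measure ℝ)]
    let m : MeasurableEmbedding fun x : ℝ => -x := (Homeomorph.neg ℝ).measurableEmbedding
    rw [m.integrableOn_map_iff]
    simp_rw [Function.comp_def, abs_neg, Set.neg_preimage, Set.neg_Iic, neg_zero]
    exact Iff.mpr integrableOn_Ici_iff_integrableOn_Ioi h1
  rw [← integrableOn_univ, ← Set.Iic_union_Ioi (a := (0 : ℝ))]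
  exact h2.union h1

/-- The p-th power is even, and on the half-line it is a Gamma integral, which converges because a p
< 1. -/
lemma memLp_rpow_mul_exp {a μ : ℝ} (hμ : 0 < μ) {p : ℝ≥0∞} (hp0 : p ≠ 0) (hp : p ≠ ∞)
    (hap : a * p.toReal < 1) :
    MemLp (fun x : ℝ => |x| ^ (-a) * Real.exp (-μ * |x|)) p volume := by
  have hp' : 0 < p.toReal := ENNReal.toReal_pos hp0 hp
  have hmeas : AEStronglyMeasurable (fun x : ℝ => |x| ^ (-a) * Real.exp (-μ * |x|)) volume := by
    refine Measurable.aestronglyMeasurable ?_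
    have : Measurable fun x : ℝ => |x| := measurable_norm
    fun_prop
  rw [← integrable_norm_rpow_iff hmeas hp0 hp]
  have h1 := integrable_comp_abs_of_integrableOn_Ioi
    (integrableOn_rpow_mul_exp_neg_mul_rpow (s := -(a * p.toReal)) (p := 1) (b := μ * p.toReal)
      (by linarith) one_pos (by positivity))
  refine h1.congr (Eventually.of_forall fun x => ?_)
  simp only []
  rw [Real.norm_of_nonneg (by positivity), Real.mul_rpow (by positivity) (by positivity),
    ← Real.rpow_mul (abs_nonneg x), ← Real.exp_mul, Real.rpow_one]
  congr 2 <;> ring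

lemma memLp_decayFn {a μ : ℝ} (hμ : 0 < μ) {p : ℝ≥0∞} (hp0 : p ≠ 0) (hp : p ≠ ∞)
    (hap : a * p.toReal < 1) : MemLp (decayFn a μ) p volume := by
  have h1 := (memLp_rpow_mul_exp (a := 0) hμ hp0 hp (by simp)).add
    (memLp_rpow_mul_exp hμ hp0 hp hap)
  refine h1.congr_norm ?_ (Eventually.of_forall fun x => ?_)
  · unfold decayFn
    refine Measurable.aestronglyMeasurable ?_
    have : Measurable fun x : ℝ => |x| := measurable_norm
    fun_prop
  · simp only [decayFn, Pi.add_apply, neg_zero, Real.rpow_zero, add_mul]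

section
variable {f f' : ℝ → ℝ}

/-- The fundamental theorem of calculus tolerates a point without derivative, here the peak, because
f is continuous. -/
lemma enorm_sub_le_lintegral (hf : Continuous f) (hd : ∀ x ≠ 0, HasDerivAt f (f' x) x)
    (hi : Integrable f') {x y : ℝ} (hxy : x ≤ y) :
    ‖f y - f x‖ₑ ≤ eLpNorm f' 1 (volume.restrict (Set.Ioc x y)) := by
  have h1 := integral_eq_of_hasDerivAt_off_countable_of_le f f' hxy (Set.countable_singleton 0)
    hf.continuousOn (fun z hz => hd z hz.2) hi.intervalIntegrable
  rw [← h1, intervalIntegral.integral_of_le hxy, eLpNorm_one_eq_lintegral_enorm]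
  exact enorm_integral_le_lintegral_enorm _

lemma enorm_le_eLpNorm_deriv (hf : Continuous f) (hd : ∀ x ≠ 0, HasDerivAt f (f' x) x)
    (hi : Integrable f') (hlim : Tendsto f atBot (𝓝 0)) (x : ℝ) :
    ‖f x‖ₑ ≤ eLpNorm f' 1 volume := by
  have h1 : Tendsto (fun y => ‖f x - f y‖ₑ) atBot (𝓝 ‖f x‖ₑ) := by
    simpa using (hlim.const_sub (f x)).enorm
  refine le_of_tendsto h1 ?_
  filter_upwards [Iic_mem_atBot x] with y hy
  exact (enorm_sub_le_lintegral hf hd hi hy).trans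
    (eLpNorm_mono_measure _ Measure.restrict_le_self)

/-- Morrey's inequality on the real line. -/
lemma eHolderNorm_le_eLpNorm_deriv (hf : Continuous f) (hd : ∀ x ≠ 0, HasDerivAt f (f' x) x)
    (hi : Integrable f') {β : ℝ≥0} (hβ : β < 1) :
    eHolderNorm β f ≤ eLpNorm f' (ENNReal.ofReal (1 - β)⁻¹) volume := by
  set q := ENNReal.ofReal (1 - (β : ℝ))⁻¹ with hq
  have hβ' : 0 < 1 - (β : ℝ) := by
    have : (β : ℝ) < 1 := by exact_mod_cast hβ
    linarith
  have hq1 : 1 ≤ q := by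
    rw [hq, ← ENNReal.ofReal_one]
    refine ENNReal.ofReal_le_ofReal ((one_le_inv₀ hβ').2 ?_)
    linarith [β.coe_nonneg]
  have hqr : q.toReal = (1 - (β : ℝ))⁻¹ := ENNReal.toReal_ofReal (by positivity)
  rcases eq_or_ne (eLpNorm f' q volume) ∞ with htop | htop
  · rw [htop]
    exact le_top
  rw [← ENNReal.coe_toNNReal htop]
  refine HolderWith.eHolderNorm_le ?_
  have key : ∀ x y : ℝ, x ≤ y →
      edist (f x) (f y) ≤ eLpNorm f' q volume * edist x y ^ (β : ℝ) := by
    intro x y hxy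
    rw [edist_comm, edist_eq_enorm_sub, edist_comm x y]
    refine (enorm_sub_le_lintegral hf hd hi hxy).trans ?_
    -- Hölder's inequality on (x, y] produces the power 1 - 1/q of the length, which is β for q =
    -- 1/(1 - β).
    refine (eLpNorm_le_eLpNorm_mul_rpow_measure_univ hq1 hi.aestronglyMeasurable.restrict).trans ?_
    have h1 : (volume.restrict (Set.Ioc x y)) Set.univ = edist y x := by
      rw [Measure.restrict_apply_univ, Real.volume_Ioc, edist_dist, Real.dist_eq,
        abs_of_nonneg (by linarith)]
    have h2 : 1 / (1 : ℝ≥0∞).toReal - 1 / q.toReal = β := by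
      rw [hqr]
      simp
    rw [h1, h2]
    gcongr
    exact Measure.restrict_le_self
  intro x y
  rw [ENNReal.coe_toNNReal htop]
  rcases le_total x y with hxy | hxy
  · exact key x y hxy
  · rw [edist_comm, edist_comm x y]
    exact key y x hxy

lemma holderENorm_le_eLpNorm_deriv (hf : Continuous f) (hd : ∀ x ≠ 0, HasDerivAt f (f' x) x)
    (hi : Integrable f') (hlim : Tendsto f atBot (𝓝 0)) {β : ℝ≥0} (hβ : β < 1) :
    holderENorm β f ≤ eLpNorm f' 1 volume + eLpNorm f' (ENNReal.ofReal (1 - β)⁻¹) volume :=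
  add_le_add (iSup_le fun x => enorm_le_eLpNorm_deriv hf hd hi hlim x)
    (eHolderNorm_le_eLpNorm_deriv hf hd hi hβ)

/-- A singularity of exponent `γ` at zero bounds the Hölder seminorms of exponents `β ≥ γ`. -/
lemma le_eHolderNorm_of_le_at_zero {γ k C : ℝ} {β : ℝ≥0} (hγ : γ < 1)
    (hγβ : γ ≤ β)
    (h : ∀ᶠ t in 𝓝[>] (0 : ℝ), k * t ^ γ - C * t ≤ |f (-t) - f 0|) :
    ENNReal.ofReal k ≤ eHolderNorm β f := by
  refine le_iInf₂ fun D hD => ?_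
  rw [← ENNReal.ofReal_coe_nnreal]
  refine ENNReal.ofReal_le_ofReal ?_
  -- The Hölder condition between -t and 0, divided by t^γ, bounds k - C t^(1-γ) by D, since t^β ≤
  -- t^γ for t < 1. The linear correction then disappears as t → 0.
  have h1 : Tendsto (fun t : ℝ => k - C * t ^ (1 - γ)) (𝓝[>] 0) (𝓝 k) := by
    have h2 : Tendsto (fun t : ℝ => t ^ (1 - γ)) (𝓝[>] 0) (𝓝 0) := by
      have h3 := (Real.continuousAt_rpow_const (0 : ℝ) (1 - γ) (Or.inr (by linarith))).tendsto
      rw [Real.zero_rpow (by linarith)] at h3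
      exact h3.mono_left nhdsWithin_le_nhds
    simpa using (h2.const_mul C).const_sub k
  refine le_of_tendsto h1 ?_
  filter_upwards [h, Ioo_mem_nhdsGT one_pos] with t ht ht1
  have h2 := hD.dist_le (-t) 0
  rw [Real.dist_eq, Real.dist_eq, sub_zero, abs_neg, abs_of_pos ht1.1] at h2
  have h3 : t ^ (β : ℝ) ≤ t ^ γ := Real.rpow_le_rpow_of_exponent_ge ht1.1 ht1.2.le hγβ
  have h4 : 0 < t ^ γ := Real.rpow_pos_of_pos ht1.1 _
  have h5 : t ^ γ * t ^ (1 - γ) = t := by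
    rw [← Real.rpow_add ht1.1]
    simp
  have h6 : (D : ℝ) * t ^ (β : ℝ) ≤ D * t ^ γ := by gcongr
  have h7 : t ^ γ * (k - C * t ^ (1 - γ)) ≤ t ^ γ * D := by
    have : t ^ γ * (k - C * t ^ (1 - γ)) = k * t ^ γ - C * (t ^ γ * t ^ (1 - γ)) := by ring
    rw [this, h5]
    linarith
  exact le_of_mul_le_mul_left h7 h4

end

/-- On (-1, 0) membership in L^p implies membership in L^(3/2), and there the power 3/2 of
|x|^(-2/3) is |x|^(-1), which is not integrable. -/
lemma not_memLp_of_rpow_le {f : ℝ → ℝ} {k : ℝ} (hk : 0 < k)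
    (h : ∀ x < 0, k * |x| ^ (-(2 / 3) : ℝ) ≤ f x + 1) {p : ℝ≥0∞} (hp : 3 / 2 ≤ p) :
    ¬ MemLp f p volume := by
  intro hf
  have h1 : MemLp f (3 / 2) (volume.restrict (Set.Ioo (-1) 0)) := hf.restrict _ |>.mono_exponent hp
  have h2 : MemLp (fun x => f x + 1) (3 / 2) (volume.restrict (Set.Ioo (-1) 0)) :=
    h1.add (memLp_const 1)
  have hmeas : Measurable fun x : ℝ => |x| ^ (-(2 / 3) : ℝ) := by
    have : Measurable fun x : ℝ => |x| := measurable_norm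
    fun_prop
  have h3 : MemLp (fun x : ℝ => |x| ^ (-(2 / 3) : ℝ)) (3 / 2)
      (volume.restrict (Set.Ioo (-1) 0)) := by
    refine h2.of_le_mul (c := k⁻¹) hmeas.aestronglyMeasurable ?_
    refine (ae_restrict_mem measurableSet_Ioo).mono fun x hx => ?_
    have h4 := h x hx.2
    have h5 : 0 ≤ |x| ^ (-(2 / 3) : ℝ) := by positivity
    rw [Real.norm_of_nonneg h5, Real.norm_of_nonneg ((by positivity : (0 : ℝ) ≤ _).trans h4),
      ← div_eq_inv_mul, le_div_iff₀ hk]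
    linarith
  have h4 := h3.integrable_norm_rpow (by norm_num) (by finiteness)
  have h5 : IntegrableOn (fun x : ℝ => |x| ^ (-1 : ℝ)) (Set.Ioo (-1) 0) := by
    refine h4.congr (Eventually.of_forall fun x => ?_)
    simp only []
    rw [Real.norm_of_nonneg (by positivity), ← Real.rpow_mul (abs_nonneg x)]
    congr 1
    simp
  have h6 : IntegrableOn (fun x : ℝ => x ^ (-1 : ℝ)) (Set.Ioo 0 1) := by
    rw [← Measure.map_neg_eq_self (volume : Measure ℝ)] at h5
    let m : MeasurableEmbedding fun x : ℝ => -x := (Homeomorph.neg ℝ).measurableEmbedding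
    rw [m.integrableOn_map_iff] at h5
    simp only [Function.comp_def, abs_neg, Set.neg_preimage, Set.neg_Ioo, neg_zero, neg_neg] at h5
    exact h5.congr_fun (fun x hx => by simp only [abs_of_pos hx.1]) measurableSet_Ioo
  rw [intervalIntegral.integrableOn_Ioo_rpow_iff one_pos] at h6
  exact lt_irrefl _ h6

/-! ### Regularity of a single wave and its behaviour at the peak -/

/-- The bounds of `exists_wave_bounds`, for given constants. -/
structure WaveBounds (C μ : ℝ) (ρ v φ : ℝ → ℝ) : Prop where
  rho : ∀ x ≠ 0, |ρ x - 1| ≤ C * decayFn (2 / 3) μ x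
  deriv_v : ∀ x ≠ 0, |deriv v x| ≤ C * decayFn (1 / 3) μ x
  deriv_phi : ∀ x ≠ 0, |deriv φ x| ≤ C * decayFn 0 μ x
  charge : ∀ x ≠ 0, |Real.exp (φ x) - ρ x| ≤ C * decayFn (2 / 3) μ x

lemma decayFn_nonneg (a μ x : ℝ) : 0 ≤ decayFn a μ x :=
  (Real.exp_pos _).le.trans (exp_le_decayFn a μ x)

lemma exists_waveBounds {k K A : ℝ} (hk : 0 < k) (hK : 0 < K) (hA : 0 < A) :
    ∃ C μ, 0 < C ∧ 0 < μ ∧ ∀ (s c : ℝ) (ρ v φ : ℝ → ℝ), ReducedWave s c ρ v φ →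
      SlopeBounds k K s c → c ≤ A → WaveBounds C μ ρ v φ := by
  obtain ⟨C, μ, hC, hμ, h⟩ := exists_wave_bounds hk hK hA
  refine ⟨3 * C, μ, by positivity, hμ, fun s c ρ v φ hw hb hc => ?_⟩
  have hmono : ∀ {y a x : ℝ}, y ≤ C * decayFn a μ x → y ≤ 3 * C * decayFn a μ x :=
    fun {y a x} hy => by
      have := mul_nonneg hC.le (decayFn_nonneg a μ x)
      linarith
  refine ⟨fun x hx => hmono (h s c ρ v φ hw hb hc x hx).1,
    fun x hx => hmono (h s c ρ v φ hw hb hc x hx).2.1,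
    fun x hx => hmono (h s c ρ v φ hw hb hc x hx).2.2.1, fun x hx => ?_⟩
  obtain ⟨h1, -, -, h2⟩ := h s c ρ v φ hw hb hc x hx
  have h3 : decayFn 0 μ x ≤ 2 * decayFn (2 / 3) μ x := by
    have h4 := exp_le_decayFn (2 / 3) μ x
    have h5 : decayFn 0 μ x = 2 * Real.exp (-μ * |x|) := by
      rw [decayFn, neg_zero, Real.rpow_zero]
      ring
    linarith
  calc |Real.exp (φ x) - ρ x| = |(Real.exp (φ x) - 1) - (ρ x - 1)| := by ring_nf
    _ ≤ |Real.exp (φ x) - 1| + |ρ x - 1| := abs_sub _ _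
    _ ≤ C * decayFn 0 μ x + C * decayFn (2 / 3) μ x := add_le_add h2 h1
    _ ≤ _ := by nlinarith

lemma ae_ne_zero : ∀ᵐ x : ℝ, x ≠ 0 := Measure.ae_ne volume 0

lemma memLp_of_abs_le_decayFn {f : ℝ → ℝ} {C a μ : ℝ} (hμ : 0 < μ)
    (hf : AEStronglyMeasurable f volume) (h : ∀ x ≠ 0, |f x| ≤ C * decayFn a μ x) {p : ℝ≥0∞}
    (hp0 : p ≠ 0) (hp : p ≠ ∞) (hap : a * p.toReal < 1) : MemLp f p volume :=
  ((memLp_decayFn hμ hp0 hp hap).const_mul C).mono' hf (ae_ne_zero.mono fun x hx => h x hx)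

lemma tendsto_eLpNorm_sub_of_decayFn {ι : Type*} {l : Filter ι} [l.IsCountablyGenerated]
    {F : ι → ℝ → ℝ} {f : ℝ → ℝ} {C a μ : ℝ} (hμ : 0 < μ)
    (hF : ∀ᶠ i in l, AEStronglyMeasurable (F i) volume) (hf : AEStronglyMeasurable f volume)
    (hFle : ∀ᶠ i in l, ∀ x ≠ 0, |F i x| ≤ C * decayFn a μ x)
    (hfle : ∀ x ≠ 0, |f x| ≤ C * decayFn a μ x)
    (hlim : ∀ x ≠ 0, Tendsto (fun i => F i x) l (𝓝 (f x))) {p : ℝ≥0∞}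
    (hp0 : p ≠ 0) (hp : p ≠ ∞) (hap : a * p.toReal < 1) :
    Tendsto (fun i => eLpNorm (fun x => F i x - f x) p volume) l (𝓝 0) := by
  refine tendsto_eLpNorm_of_dominated hp0 hp ((memLp_decayFn hμ hp0 hp hap).const_mul (C + C))
    (hF.mono fun i hi => hi.sub hf) (hFle.mono fun i hi => ae_ne_zero.mono fun x hx => ?_)
    (ae_ne_zero.mono fun x hx => ?_)
  · refine (abs_sub _ _).trans ?_
    rw [add_mul]
    exact add_le_add (hi x hx) (hfle x hx)
  · simpa using (hlim x hx).sub_const (f x)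

lemma holderExponent_ne_zero {β : ℝ≥0} (hβ : β < 1) : ENNReal.ofReal (1 - (β : ℝ))⁻¹ ≠ 0 := by
  have : (β : ℝ) < 1 := by exact_mod_cast hβ
  rw [ENNReal.ofReal_ne_zero_iff, inv_pos]
  linarith

/-- The thresholds arise here: a = 1/3 for v' permits β < 2/3, and a = 2/3 for φ'' permits α < 1/3.
-/
lemma mul_holderExponent_lt {β : ℝ≥0} {a : ℝ} (hβ : β < 1) (h : a < 1 - β) :
    a * (ENNReal.ofReal (1 - (β : ℝ))⁻¹).toReal < 1 := by
  have h1 : (β : ℝ) < 1 := by exact_mod_cast hβ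
  have h2 : 0 < 1 - (β : ℝ) := by linarith
  rw [ENNReal.toReal_ofReal (by positivity), ← div_eq_mul_inv, div_lt_one h2]
  exact h

namespace ReducedWave

variable {s c k K C μ : ℝ} {ρ v φ : ℝ → ℝ}

/-- The wave attains every relative speed in (s, c) before its peak, by the intermediate value
theorem, and there the energy is positive. This spares a direct study of the energy. -/
lemma energyOf_pos (h : ReducedWave s c ρ v φ) {u : ℝ} (hu : s < u) (huc : u < c) :
    0 < energyOf s c u := by
  obtain ⟨y, hy, hy0⟩ := ((h.v_far.eventually_lt_const (sub_pos.2 huc)).and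
    (Iio_mem_atBot (0 : ℝ))).exists
  obtain ⟨x, hx, hxu⟩ := intermediate_value_Icc (le_of_lt hy0) h.v_cont.continuousOn
    (show c - u ∈ Set.Icc (v y) (v 0) from ⟨hy.le, by rw [h.v_zero]; linarith⟩)
  have hx0 : x < 0 := by
    refine lt_of_le_of_ne hx.2 ?_
    rintro rfl
    rw [h.v_zero] at hxu
    linarith
  have := h.energy_pos x hx0
  rwa [hxu, sub_sub_cancel] at this

lemma exists_slopeBounds_nhds (h : ReducedWave s c ρ v φ) :
    ∃ k K, 0 < k ∧ 0 < K ∧ ∀ᶠ q : ℝ × ℝ in 𝓝 (s, c), CriticalPair q.1 q.2 →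
      SlopeBounds k K q.1 q.2 :=
  exists_slopeBounds h.pair fun _ hu huc => h.energyOf_pos hu huc

lemma exists_slopeBounds_self (h : ReducedWave s c ρ v φ) :
    ∃ k K, 0 < k ∧ 0 < K ∧ SlopeBounds k K s c := by
  obtain ⟨k, K, hk, hK, hb⟩ := h.exists_slopeBounds_nhds
  exact ⟨k, K, hk, hK, hb.self_of_nhds h.pair⟩

lemma exists_waveBounds_self (h : ReducedWave s c ρ v φ) :
    ∃ C μ, 0 < μ ∧ WaveBounds C μ ρ v φ := by
  obtain ⟨k, K, hk, hK, hb⟩ := h.exists_slopeBounds_self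
  obtain ⟨C, μ, -, hμ, hw⟩ := exists_waveBounds hk hK h.pair.pos
  exact ⟨C, μ, hμ, hw s c ρ v φ h hb le_rfl⟩

lemma aestronglyMeasurable_rho (h : ReducedWave s c ρ v φ) : AEStronglyMeasurable ρ volume := by
  have := h.rho_cont.aestronglyMeasurable (μ := volume) (measurableSet_singleton (0 : ℝ)).compl
  rwa [Measure.restrict_eq_self_of_ae_mem (s := {0}ᶜ) ae_ne_zero] at this

lemma continuous_deriv_phi (h : ReducedWave s c ρ v φ) : Continuous (deriv φ) :=
  h.phi_cont_diff.continuous_deriv_one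

lemma differentiable_phi (h : ReducedWave s c ρ v φ) : Differentiable ℝ φ :=
  h.phi_cont_diff.differentiable one_ne_zero

lemma aestronglyMeasurable_charge (h : ReducedWave s c ρ v φ) :
    AEStronglyMeasurable (fun x => Real.exp (φ x) - ρ x) volume :=
  (Real.continuous_exp.comp h.differentiable_phi.continuous).aestronglyMeasurable.sub
    h.aestronglyMeasurable_rho

lemma hasDerivAt_v (h : ReducedWave s c ρ v φ) {x : ℝ} (hx : x ≠ 0) :
    HasDerivAt v (deriv v x) x := by
  rcases lt_or_gt_of_ne hx with hx | hx
  · exact (h.v_deriv x hx).differentiableAt.hasDerivAt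
  · have h1 := (h.v_deriv (-x) (neg_lt_zero.2 hx)).comp x (hasDerivAt_neg x)
    rw [show v ∘ Neg.neg = v from funext h.v_even] at h1
    exact h1.differentiableAt.hasDerivAt

lemma memLp_rho (h : ReducedWave s c ρ v φ) {p : ℝ≥0∞} (hp0 : p ≠ 0) (hp : p ≠ ∞)
    (hap : 2 / 3 * p.toReal < 1) : MemLp (fun x => ρ x - 1) p volume := by
  obtain ⟨C, μ, hμ, hw⟩ := h.exists_waveBounds_self
  exact memLp_of_abs_le_decayFn hμ (h.aestronglyMeasurable_rho.sub aestronglyMeasurable_const)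
    hw.rho hp0 hp hap

lemma memLp_deriv_v (h : ReducedWave s c ρ v φ) {p : ℝ≥0∞} (hp0 : p ≠ 0) (hp : p ≠ ∞)
    (hap : 1 / 3 * p.toReal < 1) : MemLp (deriv v) p volume := by
  obtain ⟨C, μ, hμ, hw⟩ := h.exists_waveBounds_self
  exact memLp_of_abs_le_decayFn hμ (measurable_deriv v).aestronglyMeasurable
    hw.deriv_v hp0 hp hap

lemma integrable_deriv_v (h : ReducedWave s c ρ v φ) : Integrable (deriv v) :=
  memLp_one_iff_integrable.1 (h.memLp_deriv_v one_ne_zero ENNReal.one_ne_top (by norm_num))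

lemma integrable_deriv_phi (h : ReducedWave s c ρ v φ) : Integrable (deriv φ) := by
  obtain ⟨C, μ, hμ, hw⟩ := h.exists_waveBounds_self
  exact memLp_one_iff_integrable.1 (memLp_of_abs_le_decayFn hμ
    h.continuous_deriv_phi.aestronglyMeasurable hw.deriv_phi one_ne_zero ENNReal.one_ne_top
    (by norm_num))

lemma memLp_charge (h : ReducedWave s c ρ v φ) {p : ℝ≥0∞} (hp0 : p ≠ 0) (hp : p ≠ ∞)
    (hap : 2 / 3 * p.toReal < 1) : MemLp (fun x => Real.exp (φ x) - ρ x) p volume := by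
  obtain ⟨C, μ, hμ, hw⟩ := h.exists_waveBounds_self
  exact memLp_of_abs_le_decayFn hμ h.aestronglyMeasurable_charge hw.charge hp0 hp hap

lemma integrable_charge (h : ReducedWave s c ρ v φ) :
    Integrable (fun x => Real.exp (φ x) - ρ x) :=
  memLp_one_iff_integrable.1 (h.memLp_charge one_ne_zero ENNReal.one_ne_top (by norm_num))

lemma memHolderSpace_v (h : ReducedWave s c ρ v φ) {β : ℝ≥0} (hβ : β < 2 / 3) :
    MemHolderSpace β v := by
  have hβ1 : β < 1 := hβ.trans (by rw [div_lt_one] <;> norm_num)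
  have hβ' : (β : ℝ) < 2 / 3 := by exact_mod_cast hβ
  refine (holderENorm_le_eLpNorm_deriv h.v_cont (fun x hx => h.hasDerivAt_v hx)
    h.integrable_deriv_v h.v_far hβ1).trans_lt (ENNReal.add_lt_top.2 ⟨?_, ?_⟩)
  · exact (memLp_one_iff_integrable.2 h.integrable_deriv_v).2
  · exact (h.memLp_deriv_v (holderExponent_ne_zero hβ1) ENNReal.ofReal_ne_top
      (mul_holderExponent_lt hβ1 (by linarith))).2

lemma memC1HolderSpace_phi (h : ReducedWave s c ρ v φ) {α : ℝ≥0} (hα : α < 1 / 3) :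
    MemC1HolderSpace α φ := by
  have hα1 : α < 1 := hα.trans (by rw [div_lt_one] <;> norm_num)
  have hα' : (α : ℝ) < 1 / 3 := by exact_mod_cast hα
  refine ⟨h.phi_cont_diff, ENNReal.add_lt_top.2 ⟨?_, ?_⟩⟩
  · refine lt_of_le_of_lt (iSup_le fun x => enorm_le_eLpNorm_deriv
      h.differentiable_phi.continuous (fun x _ => (h.differentiable_phi x).hasDerivAt)
      h.integrable_deriv_phi h.phi_far x) ?_
    exact (memLp_one_iff_integrable.2 h.integrable_deriv_phi).2
  · refine (holderENorm_le_eLpNorm_deriv h.continuous_deriv_phi h.phi_deriv2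
      h.integrable_charge h.phi_deriv_far hα1).trans_lt (ENNReal.add_lt_top.2 ⟨?_, ?_⟩)
    · exact (memLp_one_iff_integrable.2 h.integrable_charge).2
    · exact (h.memLp_charge (holderExponent_ne_zero hα1) ENNReal.ofReal_ne_top
        (mul_holderExponent_lt hα1 (by linarith))).2

/-- At positive temperature the density is bounded. -/
lemma memLp_rho_of_pos (h : ReducedWave s c ρ v φ) (hs : 0 < s) {p : ℝ≥0∞} (hp0 : p ≠ 0) :
    MemLp (fun x => ρ x - 1) p volume := by
  obtain ⟨k, K, hk, hK, hb⟩ := h.exists_slopeBounds_self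
  have hc := h.pair.pos
  set μ := k / √c
  -- ρ - 1 = v/u, where u > s > 0 and v decays exponentially.
  have hle : ∀ x < 0, |ρ x - 1| ≤ c / s * Real.exp (-μ * |x|) := by
    intro x hx
    have h1 := h.v_le hb hk le_rfl hx
    have h2 := h.rel_pos hx
    have h3 := (h.lt_rel x hx).le
    have h4 := (h.v_pos hx)
    have h5 : ρ x - 1 = v x / (c - v x) := by
      rw [h.rho_eq x hx]
      field_simp
      ring
    rw [h5, abs_of_pos (by positivity), abs_of_neg hx, neg_mul_neg]
    calc v x / (c - v x) ≤ c * Real.exp (μ * x) / s := by gcongr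
      _ = _ := by ring
  have hle' : ∀ x ≠ 0, |ρ x - 1| ≤ c / s * Real.exp (-μ * |x|) := by
    intro x hx
    rcases lt_or_gt_of_ne hx with hx | hx
    · exact hle x hx
    · have := hle (-x) (neg_lt_zero.2 hx)
      rwa [h.rho_even x hx.ne', abs_neg x] at this
  have hμ : 0 < μ := by positivity
  have hmeas : AEStronglyMeasurable (fun x => ρ x - 1) volume :=
    h.aestronglyMeasurable_rho.sub aestronglyMeasurable_const
  rcases eq_or_ne p ∞ with rfl | hp
  · refine memLp_top_of_bound hmeas (c / s) (ae_ne_zero.mono fun x hx => (hle' x hx).trans ?_)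
    refine mul_le_of_le_one_right (by positivity) (Real.exp_le_one_iff.2 ?_)
    have := abs_nonneg x
    nlinarith
  · refine memLp_of_abs_le_decayFn (C := c / s) (a := 0) hμ hmeas (fun x hx => (hle' x hx).trans ?_)
      hp0 hp (by simp)
    gcongr
    exact exp_le_decayFn 0 μ x

/-- Without temperature the density has a singularity of order `2/3`. -/
lemma not_memLp_rho (h : ReducedWave 0 c ρ v φ) {p : ℝ≥0∞} (hp : 3 / 2 ≤ p) :
    ¬ MemLp (fun x => ρ x - 1) p volume := by
  obtain ⟨k, K, hk, hK, hb⟩ := h.exists_slopeBounds_self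
  have hc := h.pair.pos
  -- With s = 0 the bound `rel_rpow_le` reads u^(3/2) ≤ B |x|, whence ρ = c/u ≥ c (B |x|)^(-2/3).
  set B := 3 / 2 * (K * c) with hB
  have hB0 : 0 < B := by positivity
  refine not_memLp_of_rpow_le (k := c * B ^ (-(2 / 3) : ℝ)) (by positivity) (fun x hx => ?_) hp
  have h1 := h.rel_rpow_le hb hK le_rfl hx
  rw [Real.zero_rpow (by norm_num), zero_add, ← hB] at h1
  have h2 := h.rel_pos hx
  have h3 : c - v x ≤ (B * |x|) ^ (2 / 3 : ℝ) := by
    calc c - v x = ((c - v x) ^ (3 / 2 : ℝ)) ^ (2 / 3 : ℝ) := by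
          rw [← Real.rpow_mul h2.le]
          norm_num
      _ ≤ _ := by gcongr
  rw [sub_add_cancel, h.rho_eq x hx, mul_assoc, ← Real.mul_rpow hB0.le (abs_nonneg x),
    Real.rpow_neg (by positivity), ← div_eq_mul_inv]
  gcongr

/-- At positive temperature the relative speed is at most linear at the peak. -/
lemma exists_rel_le (h : ReducedWave s c ρ v φ) (hs : 0 < s) :
    ∃ D, ∀ t > 0, c - v (-t) - s ≤ D * t ∧ deriv φ (-t) ≤ D * t := by
  obtain ⟨k, K, hk, hK, hb⟩ := h.exists_slopeBounds_self
  have hc := h.pair.pos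
  have hsq := Real.sqrt_pos.2 hs
  set D := K * (c / √s) with hD
  have hD0 : 0 < D := by positivity
  -- D serves u - s. For φ', which is the slope times (u² - s²)/u, the slope is at most D and the
  -- quotient at most 2 (u - s) ≤ 2 D t.
  refine ⟨max D (D * (2 * D)), fun t ht => ?_⟩
  have hx : -t < 0 := neg_lt_zero.2 ht
  have h1 := h.rel_sub_le hb hK hs hx
  rw [abs_neg, abs_of_pos ht] at h1
  refine ⟨h1.trans (by gcongr; exact le_max_left _ _), ?_⟩
  rw [(h.phi_deriv _ hx).deriv, h.sqrt_energy_eq hx]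
  have h2 := h.rel_pos hx
  have h3 := h.lt_rel _ hx
  have h4 : slopeOf s c (c - v (-t)) ≤ D := by
    refine ((hb _ h3 (h.rel_lt _ hx)).2).trans ?_
    rw [hD, sub_sub_cancel]
    have : v (-t) ≤ c := by linarith
    gcongr
  have h5 : ((c - v (-t)) ^ 2 - s ^ 2) / (c - v (-t)) ≤ 2 * (D * t) := by
    rw [div_le_iff₀ h2]
    nlinarith
  calc _ ≤ D * (2 * (D * t)) := by
        refine mul_le_mul h4 h5 (div_nonneg ?_ h2.le) hD0.le
        nlinarith
    _ = D * (2 * D) * t := by ring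
    _ ≤ _ := by gcongr; exact le_max_right _ _

/-- Without temperature the relative speed and the field vanish at the peak with exponents `2/3`
and `1/3`. -/
lemma exists_le_rel (h : ReducedWave 0 c ρ v φ) :
    ∃ d, 0 < d ∧ ∀ᶠ t in 𝓝[>] (0 : ℝ), d * t ^ (2 / 3 : ℝ) ≤ c - v (-t) ∧
      d * t ^ (1 / 3 : ℝ) ≤ deriv φ (-t) := by
  obtain ⟨k, K, hk, hK, hb⟩ := h.exists_slopeBounds_self
  set k₁ := 3 / 4 * k with hk₁
  have hk₁0 : 0 < k₁ := by positivity
  -- The first entry comes from u ≥ (k₁ t)^(2/3). The second comes from φ' ≥ k v √u with v ≥ 1/2 and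
  -- √u ≥ (k₁ t)^(1/3), both valid once u < 1/2.
  set d := min (k₁ ^ (2 / 3 : ℝ)) (k / 2 * k₁ ^ (1 / 3 : ℝ)) with hd
  refine ⟨d, by positivity, ?_⟩
  have hlim : Tendsto (fun t => c - v (-t)) (𝓝[>] 0) (𝓝 0) := by
    have h1 : Continuous fun t => c - v (-t) := by
      have := h.v_cont
      fun_prop
    have h2 := h1.tendsto 0
    rw [neg_zero, h.v_zero, sub_zero, sub_self] at h2
    exact h2.mono_left nhdsWithin_le_nhds
  filter_upwards [hlim.eventually_lt_const (one_half_pos), self_mem_nhdsWithin] with t ht ht0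
  have ht0 : 0 < t := ht0
  have hx : -t < 0 := neg_lt_zero.2 ht0
  have h1 := h.rel_pos hx
  have h2 : k₁ * t ≤ (c - v (-t)) ^ (3 / 2 : ℝ) := by
    rcases h.rel_lower hb hk hx with h3 | h3
    · linarith
    · rwa [abs_neg, abs_of_pos ht0] at h3
  have hcrit := h.pair.one_lt
  constructor
  · calc d * t ^ (2 / 3 : ℝ) ≤ k₁ ^ (2 / 3 : ℝ) * t ^ (2 / 3 : ℝ) := by
          gcongr
          exact min_le_left _ _
      _ = (k₁ * t) ^ (2 / 3 : ℝ) := (Real.mul_rpow hk₁0.le ht0.le).symm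
      _ ≤ ((c - v (-t)) ^ (3 / 2 : ℝ)) ^ (2 / 3 : ℝ) := by gcongr
      _ = _ := by
          rw [← Real.rpow_mul h1.le]
          norm_num
  · have hsq := Real.sqrt_pos.2 h1
    have h3 : k * (v (-t) * √(c - v (-t))) ≤ deriv φ (-t) := by
      rw [(h.phi_deriv _ hx).deriv, h.sqrt_energy_eq hx]
      have h4 := (hb _ (h.lt_rel _ hx) (h.rel_lt _ hx)).1
      rw [sub_sub_cancel] at h4
      have h5 : ((c - v (-t)) ^ 2 - 0 ^ 2) / (c - v (-t)) = c - v (-t) := by field_simp; ring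
      rw [h5]
      calc k * (v (-t) * √(c - v (-t)))
          = k * (v (-t) / √(c - v (-t))) * (√(c - v (-t)) * √(c - v (-t))) := by field_simp
        _ = k * (v (-t) / √(c - v (-t))) * (c - v (-t)) := by rw [Real.mul_self_sqrt h1.le]
        _ ≤ _ := by gcongr
    have h4 : k₁ ^ (1 / 3 : ℝ) * t ^ (1 / 3 : ℝ) ≤ √(c - v (-t)) := by
      calc _ = (k₁ * t) ^ (1 / 3 : ℝ) := (Real.mul_rpow hk₁0.le ht0.le).symm
        _ ≤ ((c - v (-t)) ^ (3 / 2 : ℝ)) ^ (1 / 3 : ℝ) := by gcongr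
        _ = _ := by
            rw [← Real.rpow_mul h1.le, Real.sqrt_eq_rpow]
            norm_num
    have h5 : 1 / 2 ≤ v (-t) := by linarith
    calc d * t ^ (1 / 3 : ℝ) ≤ k / 2 * k₁ ^ (1 / 3 : ℝ) * t ^ (1 / 3 : ℝ) := by
          gcongr
          exact min_le_right _ _
      _ = k * (1 / 2 * (k₁ ^ (1 / 3 : ℝ) * t ^ (1 / 3 : ℝ))) := by ring
      _ ≤ k * (v (-t) * √(c - v (-t))) := by gcongr
      _ ≤ _ := h3

end ReducedWave

/-! ### Convergence to the cold wave and sharpness -/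

section
variable {ι : Type*} {l : Filter ι} [l.IsCountablyGenerated] {s c : ι → ℝ}
  {ρ v φ : ι → ℝ → ℝ} {c₀ : ℝ} {ρ₀ v₀ φ₀ : ℝ → ℝ}

/-- Waves approaching the cold wave obey uniform bounds and converge pointwise. -/
lemma exists_uniform_bounds (h₀ : ReducedWave 0 c₀ ρ₀ v₀ φ₀)
    (h : ∀ᶠ i in l, ReducedWave (s i) (c i) (ρ i) (v i) (φ i)) (hs : Tendsto s l (𝓝 0)) :
    ∃ C μ, 0 < μ ∧ WaveBounds C μ ρ₀ v₀ φ₀ ∧ (∀ᶠ i in l, WaveBounds C μ (ρ i) (v i) (φ i)) ∧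
      ∀ x ≠ 0, Tendsto (fun i => ρ i x) l (𝓝 (ρ₀ x)) ∧
        Tendsto (fun i => deriv (v i) x) l (𝓝 (deriv v₀ x)) ∧
        Tendsto (fun i => deriv (φ i) x) l (𝓝 (deriv φ₀ x)) ∧
        Tendsto (fun i => φ i x) l (𝓝 (φ₀ x)) := by
  have hc : Tendsto c l (𝓝 c₀) := tendsto_criticalPair h₀.pair (h.mono fun i hi => hi.pair) hs
  obtain ⟨k, K, hk, hK, hb⟩ := h₀.exists_slopeBounds_nhds
  have hb₀ := hb.self_of_nhds h₀.pair
  have hbi := (hs.prodMk_nhds hc).eventually hb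
  have hA : 0 < c₀ + 1 := by have := h₀.pair.pos; positivity
  obtain ⟨C, μ, -, hμ, hw⟩ := exists_waveBounds hk hK hA
  refine ⟨C, μ, hμ, hw _ _ _ _ _ h₀ hb₀ (by linarith), ?_, fun x hx => ?_⟩
  · filter_upwards [h, hbi, hc.eventually_lt_const (lt_add_one c₀)] with i hi hbi hci
    exact hw _ _ _ _ _ hi (hbi hi.pair) hci.le
  · refine tendsto_fields h₀ hb₀ hk ?_ hs hc hx
    filter_upwards [h, hbi] with i hi hbi using ⟨hi, hbi hi.pair⟩

lemma tendsto_eLpNorm_rho (h₀ : ReducedWave 0 c₀ ρ₀ v₀ φ₀)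
    (h : ∀ᶠ i in l, ReducedWave (s i) (c i) (ρ i) (v i) (φ i)) (hs : Tendsto s l (𝓝 0))
    {p : ℝ≥0∞} (hp0 : p ≠ 0) (hp : p ≠ ∞) (hap : 2 / 3 * p.toReal < 1) :
    Tendsto (fun i => eLpNorm (fun x => (ρ i x - 1) - (ρ₀ x - 1)) p volume) l (𝓝 0) := by
  obtain ⟨C, μ, hμ, hw₀, hw, hlim⟩ := exists_uniform_bounds h₀ h hs
  exact tendsto_eLpNorm_sub_of_decayFn hμ
    (h.mono fun i hi => hi.aestronglyMeasurable_rho.sub aestronglyMeasurable_const)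
    (h₀.aestronglyMeasurable_rho.sub aestronglyMeasurable_const) (hw.mono fun i hi => hi.rho)
    hw₀.rho (fun x hx => (hlim x hx).1.sub_const 1) hp0 hp hap

/-- By Morrey's inequality for the difference it suffices that v' converges in L¹ and in
L^(1/(1-β)), both by dominated convergence. -/
lemma tendsto_holderENorm_v (h₀ : ReducedWave 0 c₀ ρ₀ v₀ φ₀)
    (h : ∀ᶠ i in l, ReducedWave (s i) (c i) (ρ i) (v i) (φ i)) (hs : Tendsto s l (𝓝 0))
    {β : ℝ≥0} (hβ : β < 2 / 3) :
    Tendsto (fun i => holderENorm β (fun x => v i x - v₀ x)) l (𝓝 0) := by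
  obtain ⟨C, μ, hμ, hw₀, hw, hlim⟩ := exists_uniform_bounds h₀ h hs
  have hβ1 : β < 1 := hβ.trans (by rw [div_lt_one] <;> norm_num)
  have hβ' : (β : ℝ) < 2 / 3 := by exact_mod_cast hβ
  have hconv : ∀ {p : ℝ≥0∞}, p ≠ 0 → p ≠ ∞ → 1 / 3 * p.toReal < 1 →
      Tendsto (fun i => eLpNorm (fun x => deriv (v i) x - deriv v₀ x) p volume) l (𝓝 0) :=
    fun hp0 hp hap => tendsto_eLpNorm_sub_of_decayFn hμ
      (Eventually.of_forall fun i => (measurable_deriv _).aestronglyMeasurable)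
      (measurable_deriv _).aestronglyMeasurable (hw.mono fun i hi => hi.deriv_v)
      hw₀.deriv_v (fun x hx => (hlim x hx).2.1) hp0 hp hap
  have h1 := (hconv one_ne_zero ENNReal.one_ne_top (by norm_num)).add
    (hconv (holderExponent_ne_zero hβ1) ENNReal.ofReal_ne_top
      (mul_holderExponent_lt hβ1 (by linarith)))
  rw [add_zero] at h1
  refine tendsto_of_tendsto_of_tendsto_of_le_of_le' tendsto_const_nhds h1
    (Eventually.of_forall fun _ => zero_le) (h.mono fun i hi => ?_)
  exact holderENorm_le_eLpNorm_deriv (f := fun x => v i x - v₀ x) (hi.v_cont.sub h₀.v_cont)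
    (fun x hx => (hi.hasDerivAt_v hx).sub (h₀.hasDerivAt_v hx))
    (hi.integrable_deriv_v.sub h₀.integrable_deriv_v)
    (by simpa using hi.v_far.sub h₀.v_far) hβ1

lemma ReducedWave.deriv_phi_sub {s c s' c' : ℝ} {ρ v φ ρ' v' φ' : ℝ → ℝ}
    (h : ReducedWave s c ρ v φ) (h' : ReducedWave s' c' ρ' v' φ') :
    deriv (fun x => φ x - φ' x) = fun x => deriv φ x - deriv φ' x :=
  funext fun x => deriv_fun_sub (h.differentiable_phi x) (h'.differentiable_phi x)

/-- Convergence of φ' in L¹ controls the supremum of φ; the rest of the norm is controlled by φ'' =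
exp φ - ρ in L¹ and L^(1/(1-α)). -/
lemma tendsto_c1HolderENorm_phi (h₀ : ReducedWave 0 c₀ ρ₀ v₀ φ₀)
    (h : ∀ᶠ i in l, ReducedWave (s i) (c i) (ρ i) (v i) (φ i)) (hs : Tendsto s l (𝓝 0))
    {α : ℝ≥0} (hα : α < 1 / 3) :
    Tendsto (fun i => c1HolderENorm α (fun x => φ i x - φ₀ x)) l (𝓝 0) := by
  obtain ⟨C, μ, hμ, hw₀, hw, hlim⟩ := exists_uniform_bounds h₀ h hs
  have hα1 : α < 1 := hα.trans (by rw [div_lt_one] <;> norm_num)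
  have hα' : (α : ℝ) < 1 / 3 := by exact_mod_cast hα
  have hconv : ∀ {p : ℝ≥0∞}, p ≠ 0 → p ≠ ∞ → 2 / 3 * p.toReal < 1 →
      Tendsto (fun i => eLpNorm (fun x => (Real.exp (φ i x) - ρ i x) -
        (Real.exp (φ₀ x) - ρ₀ x)) p volume) l (𝓝 0) :=
    fun hp0 hp hap => tendsto_eLpNorm_sub_of_decayFn hμ
      (h.mono fun i hi => hi.aestronglyMeasurable_charge)
      h₀.aestronglyMeasurable_charge (hw.mono fun i hi => hi.charge)
      hw₀.charge (fun x hx => ((Real.continuous_exp.tendsto _).comp (hlim x hx).2.2.2).sub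
        (hlim x hx).1) hp0 hp hap
  have h1 : Tendsto (fun i => eLpNorm (fun x => deriv (φ i) x - deriv φ₀ x) 1 volume) l (𝓝 0) :=
    tendsto_eLpNorm_sub_of_decayFn hμ
      (h.mono fun i hi => hi.continuous_deriv_phi.aestronglyMeasurable)
      h₀.continuous_deriv_phi.aestronglyMeasurable (hw.mono fun i hi => hi.deriv_phi)
      hw₀.deriv_phi (fun x hx => (hlim x hx).2.2.1) one_ne_zero ENNReal.one_ne_top (by norm_num)
  have h2 := h1.add ((hconv one_ne_zero ENNReal.one_ne_top (by norm_num)).add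
    (hconv (holderExponent_ne_zero hα1) ENNReal.ofReal_ne_top
      (mul_holderExponent_lt hα1 (by linarith))))
  simp only [add_zero] at h2
  refine tendsto_of_tendsto_of_tendsto_of_le_of_le' tendsto_const_nhds h2
    (Eventually.of_forall fun _ => zero_le) (h.mono fun i hi => ?_)
  rw [c1HolderENorm, hi.deriv_phi_sub h₀]
  refine add_le_add (iSup_le fun x => ?_) ?_
  · exact enorm_le_eLpNorm_deriv (f := fun x => φ i x - φ₀ x)
      (hi.differentiable_phi.continuous.sub h₀.differentiable_phi.continuous)
      (fun x _ => (hi.differentiable_phi x).hasDerivAt.sub (h₀.differentiable_phi x).hasDerivAt)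
      (hi.integrable_deriv_phi.sub h₀.integrable_deriv_phi)
      (by simpa using hi.phi_far.sub h₀.phi_far) x
  · exact holderENorm_le_eLpNorm_deriv (f := fun x => deriv (φ i) x - deriv φ₀ x)
      (hi.continuous_deriv_phi.sub h₀.continuous_deriv_phi)
      (fun x hx => (hi.phi_deriv2 x hx).sub (h₀.phi_deriv2 x hx))
      (hi.integrable_charge.sub h₀.integrable_charge)
      (by simpa using hi.phi_deriv_far.sub h₀.phi_deriv_far) hα1

end

section
variable {s c c₀ : ℝ} {ρ v φ ρ₀ v₀ φ₀ : ℝ → ℝ}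

/-- Warm waves stay away from the cold wave in Hölder spaces of large exponent. -/
lemma exists_le_holderENorm (h₀ : ReducedWave 0 c₀ ρ₀ v₀ φ₀) :
    ∃ d, 0 < d ∧ ∀ {s c : ℝ} {ρ v φ : ℝ → ℝ}, ReducedWave s c ρ v φ → 0 < s →
      (∀ α : ℝ≥0, 1 / 3 ≤ α → ENNReal.ofReal d ≤ c1HolderENorm α (fun x => φ x - φ₀ x)) ∧
      ∀ β : ℝ≥0, 2 / 3 ≤ β → ENNReal.ofReal d ≤ holderENorm β (fun x => v x - v₀ x) := by
  obtain ⟨d, hd, hev⟩ := h₀.exists_le_rel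
  refine ⟨d, hd, fun {s c ρ v φ} h hs => ?_⟩
  -- D depends on the warm wave, but it only enters through the linear term D t, which does not
  -- affect the Hölder lower bound. The surviving constant d depends on the cold wave alone.
  obtain ⟨D, hD⟩ := h.exists_rel_le hs
  refine ⟨fun α hα => ?_, fun β hβ => ?_⟩
  · have hα' : (1 / 3 : ℝ) ≤ α := by exact_mod_cast hα
    rw [c1HolderENorm, h.deriv_phi_sub h₀, holderENorm]
    refine le_trans ?_ (le_add_self.trans le_add_self)
    refine le_eHolderNorm_of_le_at_zero (γ := 1 / 3) (C := D) (by norm_num) hα' ?_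
    filter_upwards [hev, self_mem_nhdsWithin] with t ht ht0
    have h1 := (hD t ht0).2
    rw [h.phi_deriv_zero, h₀.phi_deriv_zero, sub_zero, sub_zero, abs_sub_comm]
    exact le_trans (by linarith [ht.2]) (le_abs_self _)
  · have hβ' : (2 / 3 : ℝ) ≤ β := by exact_mod_cast hβ
    refine le_trans ?_ le_add_self
    refine le_eHolderNorm_of_le_at_zero (γ := 2 / 3) (C := D) (by norm_num) hβ' ?_
    filter_upwards [hev, self_mem_nhdsWithin] with t ht ht0
    have h1 := (hD t ht0).1
    rw [h.v_zero, h₀.v_zero]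
    exact le_trans (by linarith [ht.1]) (le_abs_self _)

/-- The warm density minus one lies in this L^p, so a finite difference would put the cold one there
as well. -/
lemma eLpNorm_rho_sub_eq_top (h₀ : ReducedWave 0 c₀ ρ₀ v₀ φ₀) (h : ReducedWave s c ρ v φ)
    (hs : 0 < s) {p : ℝ≥0∞} (hp : 3 / 2 ≤ p) :
    eLpNorm (fun x => (ρ x - 1) - (ρ₀ x - 1)) p volume = ∞ := by
  by_contra hne
  have hp0 : p ≠ 0 := (lt_of_lt_of_le (by simp) hp).ne'
  have h1 := h.memLp_rho_of_pos hs hp0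
  have h2 : MemLp (fun x => (ρ x - 1) - (ρ₀ x - 1)) p volume :=
    ⟨(h.aestronglyMeasurable_rho.sub aestronglyMeasurable_const).sub
      (h₀.aestronglyMeasurable_rho.sub aestronglyMeasurable_const), lt_top_iff_ne_top.2 hne⟩
  refine h₀.not_memLp_rho hp ((h1.sub h2).congr_norm
    (h₀.aestronglyMeasurable_rho.sub aestronglyMeasurable_const)
    (Eventually.of_forall fun x => ?_))
  simp

end

theorem theorem1p3 (c : ℝ → ℝ) (ρ v φ : ℝ → ℝ → ℝ)
    (hc : ∀ κ, 0 ≤ κ → IsCriticalSpeed κ (c κ))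
    (hw : ∀ κ, 0 ≤ κ → IsPeakedSolitaryWave κ (c κ) (ρ κ) (v κ) (φ κ)) :
    -- convergence of the potential, the density and the velocity
    (∀ α : ℝ≥0, 0 < α → α < 1 / 3 →
      (∀ κ, 0 ≤ κ → MemC1HolderSpace α (φ κ)) ∧
      Tendsto (fun κ => c1HolderENorm α (fun ξ => φ κ ξ - φ 0 ξ)) (𝓝[>] 0) (𝓝 0)) ∧
    (∀ p : ℝ≥0∞, 1 ≤ p → p < 3 / 2 →
      (∀ κ, 0 ≤ κ → MemLp (fun ξ => ρ κ ξ - 1) p volume) ∧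
      Tendsto (fun κ => eLpNorm (fun ξ => (ρ κ ξ - 1) - (ρ 0 ξ - 1)) p volume)
        (𝓝[>] 0) (𝓝 0)) ∧
    (∀ β : ℝ≥0, 0 < β → β < 2 / 3 →
      (∀ κ, 0 ≤ κ → MemHolderSpace β (v κ)) ∧
      Tendsto (fun κ => holderENorm β (fun ξ => v κ ξ - v 0 ξ)) (𝓝[>] 0) (𝓝 0)) ∧
    -- sharpness of the three ranges of exponents
    (∀ α : ℝ≥0, 1 / 3 ≤ α → α ≤ 1 →
      ∃ δ : ℝ≥0∞, 0 < δ ∧ ∀ κ, 0 < κ →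
        δ ≤ c1HolderENorm α (fun ξ => φ κ ξ - φ 0 ξ)) ∧
    (∀ p : ℝ≥0∞, 3 / 2 ≤ p →
      ¬ MemLp (fun ξ => ρ 0 ξ - 1) p volume ∧
      ∀ κ, 0 < κ → eLpNorm (fun ξ => (ρ κ ξ - 1) - (ρ 0 ξ - 1)) p volume = ∞) ∧
    (∀ β : ℝ≥0, 2 / 3 ≤ β → β ≤ 1 →
      ∃ δ : ℝ≥0∞, 0 < δ ∧ ∀ κ, 0 < κ →
        δ ≤ holderENorm β (fun ξ => v κ ξ - v 0 ξ)) := by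
  have hR : ∀ κ, 0 ≤ κ → ReducedWave (√κ) (c κ) (ρ κ) (v κ) (φ κ) := fun κ hκ =>
    (hw κ hκ).reducedWave hκ (hc κ hκ).criticalPair
  have h₀ : ReducedWave 0 (c 0) (ρ 0) (v 0) (φ 0) := by simpa using hR 0 le_rfl
  have hev : ∀ᶠ κ in 𝓝[>] (0 : ℝ), ReducedWave (√κ) (c κ) (ρ κ) (v κ) (φ κ) := by
    filter_upwards [self_mem_nhdsWithin] with κ hκ using hR κ (le_of_lt hκ)
  have hs : Tendsto (fun κ : ℝ => √κ) (𝓝[>] 0) (𝓝 0) := by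
    have := Real.continuous_sqrt.tendsto 0
    rw [Real.sqrt_zero] at this
    exact this.mono_left nhdsWithin_le_nhds
  obtain ⟨d, hd, hsharp⟩ := exists_le_holderENorm h₀
  refine ⟨fun α _ hα => ⟨fun κ hκ => (hR κ hκ).memC1HolderSpace_phi hα,
      tendsto_c1HolderENorm_phi h₀ hev hs hα⟩, fun p hp1 hp => ?_,
    fun β _ hβ => ⟨fun κ hκ => (hR κ hκ).memHolderSpace_v hβ,
      tendsto_holderENorm_v h₀ hev hs hβ⟩,
    fun α hα _ => ⟨ENNReal.ofReal d, ENNReal.ofReal_pos.2 hd, fun κ hκ =>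
      (hsharp (hR κ hκ.le) (Real.sqrt_pos.2 hκ)).1 α hα⟩,
    fun p hp => ⟨h₀.not_memLp_rho hp, fun κ hκ =>
      eLpNorm_rho_sub_eq_top h₀ (hR κ hκ.le) (Real.sqrt_pos.2 hκ) hp⟩,
    fun β hβ _ => ⟨ENNReal.ofReal d, ENNReal.ofReal_pos.2 hd, fun κ hκ =>
      (hsharp (hR κ hκ.le) (Real.sqrt_pos.2 hκ)).2 β hβ⟩⟩
  have hp0 : p ≠ 0 := (zero_lt_one.trans_le hp1).ne'
  have hpt : p ≠ ∞ := hp.ne_top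
  have hap : 2 / 3 * p.toReal < 1 := by
    have h1 : p.toReal < (3 / 2 : ℝ≥0∞).toReal := ENNReal.toReal_strict_mono (by finiteness) hp
    rw [ENNReal.toReal_div] at h1
    norm_num at h1
    linarith
  exact ⟨fun κ hκ => (hR κ hκ).memLp_rho hp0 hpt hap,
    tendsto_eLpNorm_rho h₀ hev hs hp0 hpt hap⟩
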